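/- Fix integers $d,k\ge 1$, a basis $\hat{\mathcal B}=\{\hat\varphi_a\}$ of the space $\mathbb P_k(\mathbb R^d)$ of polynomials of degree at most $k$ (the reference basis, for instance the Lagrange basis on the reference simplex $\hat T$), and constants $\rho>0$, $\gamma\in(0,1]$, $\tau>0$, $N\in\mathbb N$. Then there is a constant $C>0$, depending only on these data, such that the following holds. **Setting.** Let $\mathcal T_{h,0}$ be a finite conforming mesh of closed $d$-simplices covering $\Omega_0\subset\mathbb R^d$, quasiuniform with parameter $h>0$: each element has diameter at most $h$ and contains a ball of radius $\rho h$. Let $\Omega\subset\Omega_0$ be closed, $\mathcal T_h=\{T\in\mathcal T_{h,0}:T\cap\Omega\ne\emptyset\}$, $\Omega_h=\bigcup_{T\in\mathcal T_h}T$, and $V_h=V_{h,0}|_{\Omega_h}$ with $V_{h,0}=\{v\in C^0(\Omega_0): v|_T\in\mathbb P_k(T)\ \forall T\in\mathcal T_{h,0}\}$. Let $\{\varphi_i\}_{i\in I}$ be a finite element basis of $V_h$, that is, a basis of $V_h$ such that for each $T\in\mathcal T_h$ the functions $\varphi_i|_T$, $i\in I_T=\{i:T\subset\operatorname{supp}\varphi_i\}$,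 are the functions $\hat\varphi_a\circ F_T^{-1}$ for some affine bijection $F_T:\hat T\to T$. For $i\in I_T$ let $\varphi_{i,T}^*$ be the degree of freedom on $T$, i.e. the functional with $\varphi^*_{i,T}(\varphi_j|_T)=\delta_{ij}$ for $j\in I_T$. For $v\in V_h$ let $[v]_{T_1,T_2}=(v|_{T_1})^e-(v|_{T_2})^e\in\mathbb P_k(\mathbb R^d)$, where $(\cdot)^e$ is the extension to a polynomial on $\mathbb R^d$. Let $\mathcal T_h^L=\{T\in\mathcal T_h:|T\cap\Omega|\ge\gamma|T|\}$ (large elements), $\mathcal T_h^S=\mathcal T_h\setminus\mathcal T_h^L$ (small elements), and let $S_h:\mathcal T_h^S\to\mathcal T_h^L$ be any map. Let $I^S$ be the set of $i\in I$ such that $\operatorname{supp}\varphi_i$ contains no large element, and for $i\in I^S$ let $T_i\in\mathcal T_h$ be any element with $T_i\subset\operatorname{supp}\varphi_i$. For $m=0,1$ define $$s_{h,m}(v,w)=\sum_{i\in I^S}\tau h^{d-2m}\,\varphi^*_{i,T_i}([v]_{T_i,S_h(T_i)})\,\varphi^*_{i,T_i}([w]_{T_i,S_h(T_i)}),\qquad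 \|v\|^2_{s_{h,m}}=s_{h,m}(v,v).$$ **Assumptions.** A path is a finite sequence of elements in which consecutive elements share a face, that is, have exactly $d$ common vertices. * (A2) For each $i\in I^S$ there is a path of at most $N$ elements of $\mathcal T_h$ from $T_i$ to $S_h(T_i)$. * (A3) For each $i\in I$: if $T_1,T_2\in\mathcal T_h^S$ are contained in $\operatorname{supp}\varphi_i$, there is a path of at most $N$ elements, all in $\mathcal T_h^L$, from $S_h(T_1)$ to $S_h(T_2)$; if $T_1\in\mathcal T_h^L$ and $T_2\in\mathcal T_h^S$ are contained in $\operatorname{supp}\varphi_i$, there is such a path from $T_1$ to $S_h(T_2)$. **Conclusion.** If (A2) holds, then $$\|v\|^2_{\Omega_h}\le C\big(\|v\|^2_{\Omega}+\|v\|^2_{s_{h,0}}\big)\qquad\text{for all } v\in V_h,$$ and if (A2) and (A3) hold, then also $$\|\nabla v\|^2_{\Omega_h}\le C\big(\|\nabla v\|^2_{\Omega}+\|v\|^2_{s_{h,1}}\big)\qquad\text{for all } v\in V_h,$$ where $\|\cdot\|_X$ is the $L^2(X)$ norm. In particular $C$ does not depend on $h$, the mesh, $\Omega$, $S_h$ or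 the elements $T_i$. -/

import Mathlib

open MeasureTheory

noncomputable section

namespace NodalStab

/-- Euclidean space `ℝ^d`. -/
abbrev E (d : ℕ) : Type := EuclideanSpace ℝ (Fin d)

/-- Evaluation of formal polynomials in `d` variables as functions on `ℝ^d`. -/
def evalPoly (d : ℕ) : MvPolynomial (Fin d) ℝ →ₗ[ℝ] (E d → ℝ) :=
  LinearMap.pi fun x => (MvPolynomial.aeval fun i => x i).toLinearMap

/-- `ℙ_k(ℝ^d)`: the polynomial functions on `ℝ^d` of total degree at most `k`. -/
def polySpace (d k : ℕ) : Submodule ℝ (E d → ℝ) :=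
  (MvPolynomial.restrictTotalDegree (Fin d) ℝ k).map (evalPoly d)

/-- The reference simplex `{x : x_i ≥ 0, ∑ x_i ≤ 1}`. -/
def refSimplex (d : ℕ) : Set (E d) := {x | (∀ i, 0 ≤ x i) ∧ ∑ i, x i ≤ 1}

/-! ### Meshes -/

/-- A (conforming) simplicial mesh in `ℝ^d`: a finite geometric simplicial complex in which every
face is a face of some `d`-simplex. Simplices are given by their vertex sets. -/
structure Mesh (d : ℕ) where
  /-- the underlying geometric simplicial complex -/
  cplx : Geometry.SimplicialComplex ℝ (E d)
  finite_faces : cplx.faces.Finite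
  pure : ∀ s ∈ cplx.faces, ∃ t ∈ cplx.faces, s ⊆ t ∧ t.card = d + 1

/-- The closed simplex with vertex set `T`. -/
abbrev body {d : ℕ} (T : Finset (E d)) : Set (E d) := convexHull ℝ (T : Set (E d))

/-- The elements of the background mesh `𝒯_{h,0}`, i.e. the `d`-simplices. -/
def Mesh.elements {d : ℕ} (M : Mesh d) : Set (Finset (E d)) :=
  {T | T ∈ M.cplx.faces ∧ T.card = d + 1}

/-- `Ω₀`, the closed polygonal region covered by the background mesh. -/
def Mesh.domain {d : ℕ} (M : Mesh d) : Set (E d) := M.cplx.space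

/-- Quasiuniformity with mesh parameter `h`: every element has diameter at most `h` and contains
a ball of radius `ρ * h`. -/
def Mesh.IsQuasiuniform {d : ℕ} (M : Mesh d) (h ρ : ℝ) : Prop :=
  ∀ T ∈ M.elements, Metric.diam (body T) ≤ h ∧ ∃ x, Metric.closedBall x (ρ * h) ⊆ body T

/-- The active mesh `𝒯_h`: the elements that meet `Ω`. -/
def active {d : ℕ} (M : Mesh d) (Ω : Set (E d)) : Set (Finset (E d)) :=
  {T | T ∈ M.elements ∧ (body T ∩ Ω).Nonempty}

/-- `Ω_h`, the union of the active elements. -/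
def activeDomain {d : ℕ} (M : Mesh d) (Ω : Set (E d)) : Set (E d) :=
  ⋃ T ∈ active M Ω, body T

/-- `𝒯_h^L`: the active elements with `|T ∩ Ω| ≥ γ |T|`. -/
def largeElems {d : ℕ} (M : Mesh d) (Ω : Set (E d)) (γ : ℝ) : Set (Finset (E d)) :=
  {T | T ∈ active M Ω ∧ γ * volume.real (body T) ≤ volume.real (body T ∩ Ω)}

/-- `𝒯_h^S = 𝒯_h \ 𝒯_h^L`. -/
def smallElems {d : ℕ} (M : Mesh d) (Ω : Set (E d)) (γ : ℝ) : Set (Finset (E d)) :=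
  active M Ω \ largeElems M Ω γ

/-! ### Finite element spaces -/

/-- `V_{h,0}`: the functions that are continuous on `Ω₀` and whose restriction to each element is
a polynomial of degree at most `k` (values outside `Ω₀` are irrelevant). -/
def bgSpace {d : ℕ} (M : Mesh d) (k : ℕ) : Submodule ℝ (E d → ℝ) where
  carrier := {v | ContinuousOn v M.domain ∧
    ∀ T ∈ M.elements, ∃ p ∈ polySpace d k, Set.EqOn v p (body T)}
  zero_mem' := ⟨continuousOn_const, fun _ _ => ⟨0, Submodule.zero_mem _, fun _ _ => rfl⟩⟩
  add_mem' := by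
    rintro v w ⟨hv, hv'⟩ ⟨hw, hw'⟩
    refine ⟨hv.add hw, fun T hT => ?_⟩
    obtain ⟨p, hp, hpv⟩ := hv' T hT
    obtain ⟨q, hq, hqw⟩ := hw' T hT
    exact ⟨p + q, Submodule.add_mem _ hp hq, fun x hx => by simp [hpv hx, hqw hx]⟩
  smul_mem' := by
    rintro c v ⟨hv, hv'⟩
    refine ⟨hv.const_smul c, fun T hT => ?_⟩
    obtain ⟨p, hp, hpv⟩ := hv' T hT
    exact ⟨c • p, Submodule.smul_mem _ c hp, fun x hx => by simp [hpv hx]⟩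

/-- Restriction of functions to `X`; a function on `X` is represented by its extension by zero. -/
def restrictTo {d : ℕ} (X : Set (E d)) : (E d → ℝ) →ₗ[ℝ] (E d → ℝ) where
  toFun v := X.indicator v
  map_add' v w := Set.indicator_add X v w
  map_smul' c v := Set.indicator_const_smul X c v

/-- The active finite element space `V_h = V_{h,0}|_{Ω_h}`. -/
def feSpace {d : ℕ} (M : Mesh d) (Ω : Set (E d)) (k : ℕ) : Submodule ℝ (E d → ℝ) :=
  (bgSpace M k).map (restrictTo (activeDomain M Ω))

/-- `I_T`: the indices `i` with `T ⊆ supp φ_i`. -/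
def localIdx {d : ℕ} {I : Type} (φ : I → E d → ℝ) (T : Finset (E d)) : Set I :=
  {i | body T ⊆ tsupport (φ i)}

/-- A family `φ` is affine equivalent to the reference basis `φhat` of `ℙ_k`: on each active
element `T`, the shape functions `φ_i|_T`, `i ∈ I_T`, are the functions `φhat a ∘ F⁻¹` for some
affine bijection `F` from the reference simplex onto `T`. -/
def IsAffineEquivalent {d k : ℕ} {A I : Type} (M : Mesh d) (Ω : Set (E d))
    (φhat : Module.Basis A ℝ (polySpace d k)) (φ : I → E d → ℝ) : Prop :=
  ∀ T ∈ active M Ω, ∃ (F : E d ≃ᵃ[ℝ] E d) (ι : A → I),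
    F '' refSimplex d = body T ∧ Set.range ι = localIdx φ T ∧
      ∀ a, ∀ x ∈ refSimplex d, φ (ι a) (F x) = (φhat a : E d → ℝ) x

open Classical in
/-- The element degree of freedom `φ*_{i,T}` applied to `p`: the coefficient of `φ_i|_T` in the
expansion of `p|_T` in the element basis `{φ_j|_T : j ∈ I_T}`. -/
def dof {d : ℕ} {I : Type} [Fintype I] (φ : I → E d → ℝ) (i : I) (T : Finset (E d))
    (p : E d → ℝ) : ℝ :=
  if h : ∃ c : I → ℝ, ∀ x ∈ body T, p x = ∑ j with j ∈ localIdx φ T, c j * φ j x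
  then h.choose i else 0

open Classical in
/-- The canonical polynomial extension `(v|_T)^e ∈ ℙ_k(ℝ^d)` of `v|_T`. -/
def polyExt {d : ℕ} (k : ℕ) (v : E d → ℝ) (T : Finset (E d)) : E d → ℝ :=
  if h : ∃ p ∈ polySpace d k, Set.EqOn v p (body T) then h.choose else 0

/-- The jump `[v]_{T₁,T₂} = (v|_{T₁})^e - (v|_{T₂})^e`. -/
def jump {d : ℕ} (k : ℕ) (v : E d → ℝ) (T₁ T₂ : Finset (E d)) : E d → ℝ :=
  polyExt k v T₁ - polyExt k v T₂

/-! ### The nodal stabilization form -/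

/-- `I^S`: the indices whose basis functions have no large element in their support. -/
def smallIdx {d : ℕ} {I : Type} (M : Mesh d) (Ω : Set (E d)) (γ : ℝ) (φ : I → E d → ℝ) : Set I :=
  {i | ∀ T ∈ largeElems M Ω γ, i ∉ localIdx φ T}

open Classical in
/-- The nodal stabilization form
`s_{h,m}(v,w) = ∑_{i ∈ I^S} τ h^(d-2m) φ*_{i,T_i}([v]_{T_i,S(T_i)}) φ*_{i,T_i}([w]_{T_i,S(T_i)})`,
where `Ts i` is the element `T_i`. -/
def stabForm {d : ℕ} {I : Type} [Fintype I] (k : ℕ) (M : Mesh d) (Ω : Set (E d)) (γ τ h : ℝ)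
    (φ : I → E d → ℝ) (S : Finset (E d) → Finset (E d)) (Ts : I → Finset (E d)) (m : ℕ)
    (v w : E d → ℝ) : ℝ :=
  ∑ i with i ∈ smallIdx M Ω γ φ,
    τ * h ^ ((d : ℤ) - 2 * (m : ℤ)) * dof φ i (Ts i) (jump k v (Ts i) (S (Ts i))) *
      dof φ i (Ts i) (jump k w (Ts i) (S (Ts i)))

/-! ### Paths of elements -/

/-- Two elements are face neighbors: they have exactly `d` common vertices. -/
def FaceNeighbors {d : ℕ} (T₁ T₂ : Finset (E d)) : Prop :=
  ((T₁ : Set (E d)) ∩ (T₂ : Set (E d))).ncard = d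

/-- There is a path `P 1, …, P n` of `n ≤ N` face neighboring elements of `𝒯` from `T` to `T'`. -/
def HasPath {d : ℕ} (𝒯 : Set (Finset (E d))) (N : ℕ) (T T' : Finset (E d)) : Prop :=
  ∃ (n : ℕ) (P : ℕ → Finset (E d)), 1 ≤ n ∧ n ≤ N ∧ P 1 = T ∧ P n = T' ∧
    (∀ j, 1 ≤ j → j ≤ n → P j ∈ 𝒯) ∧ (∀ j, 1 ≤ j → j < n → FaceNeighbors (P j) (P (j + 1)))

/-- Path assumption for the nodal stabilization: each `T_i`, `i ∈ I^S`, is joined to `S(T_i)` by a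
path of at most `N` active elements. -/
def PathAssumption {d : ℕ} {I : Type} (M : Mesh d) (Ω : Set (E d)) (γ : ℝ) (φ : I → E d → ℝ)
    (S : Finset (E d) → Finset (E d)) (Ts : I → Finset (E d)) (N : ℕ) : Prop :=
  ∀ i ∈ smallIdx M Ω γ φ, HasPath (active M Ω) N (Ts i) (S (Ts i))

/-- Large-path assumption. For small elements `T₁, T₂ ⊆ supp φ_i`, there is a path of at most `N` large
elements from `S(T₁)` to `S(T₂)`; for `T₁` large and `T₂` small in `supp φ_i`, there is a path of
at most `N` large elements from `T₁` to `S(T₂)`. -/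
def LargePathAssumption {d : ℕ} {I : Type} (M : Mesh d) (Ω : Set (E d)) (γ : ℝ) (φ : I → E d → ℝ)
    (S : Finset (E d) → Finset (E d)) (N : ℕ) : Prop :=
  (∀ i, ∀ T₁ ∈ smallElems M Ω γ, ∀ T₂ ∈ smallElems M Ω γ,
    i ∈ localIdx φ T₁ → i ∈ localIdx φ T₂ → HasPath (largeElems M Ω γ) N (S T₁) (S T₂)) ∧
  (∀ i, ∀ T₁ ∈ largeElems M Ω γ, ∀ T₂ ∈ smallElems M Ω γ,
    i ∈ localIdx φ T₁ → i ∈ localIdx φ T₂ → HasPath (largeElems M Ω γ) N T₁ (S T₂))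

/-! ### Norms -/

/-- `‖v‖²_X`. -/
def normSq {d : ℕ} (X : Set (E d)) (v : E d → ℝ) : ℝ := ∫ x in X, v x ^ 2

/-- `‖∇v‖²_X`. For `v ∈ V_h` and `X ⊆ Ω_h` the pointwise gradient exists off the (null) union of
the element boundaries and is the weak gradient. -/
def gradNormSq {d : ℕ} (X : Set (E d)) (v : E d → ℝ) : ℝ := ∫ x in X, ‖gradient v x‖ ^ 2

end NodalStab

end

namespace NodalStab

/-! ### Polynomial functions on Euclidean space. -/

section

variable {d k : ℕ}

/-! On an active element `T`, a finite element function is determined by its global coefficients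
with index in `I_T`, and the size of those coefficients is equivalent to its maximum norm on `T`
(`exists_local_bounds`). It therefore suffices to bound coefficients.

If `supp φ_i` contains a large element, the coefficient is read off there. On a large element the
polynomial is controlled by its `L²` norm on the part inside `Ω`, whose volume is at least a fixed
multiple of `h ^ d`. If `i ∈ I^S`, the coefficient is read off on `T_i`: there `v` is the extension
of `v|_{S(T_i)}` plus the jump. The path assumption puts `S(T_i)` within distance `N * h`, so the
extension is bounded on `T_i` by the values on `S(T_i)`, and the remaining part is exactly the
degree of freedom penalized by the form. This is `exists_coeff_le`; `exists_element_bound` turns it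
into a pointwise bound for values and gradients on `T`. Multiplication by `h ^ d` and summation over
`T` costs only a finite overlap constant.

For the gradient, large elements are treated directly. On a small `T`, a constant, the value of `v`
at a vertex of `S(T)`, is subtracted first; this changes neither gradients nor jumps. The mean value
inequality along paths of large elements bounds the shifted function by `N * h` times a gradient
bound, and the inverse inequality divides by `h` again, which accounts for the weight `h ^ (d - 2)`.

Two facts carry the uniformity. The first is `exists_coeff_sq_le`: a compactness argument giving one
constant for all measurable subsets of a ball with volume bounded below, so that the shape of `T ∩
Ω` is irrelevant. The second is `exists_common_vertex`: although the basis is abstract, all elements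
in one support share a vertex, so supports have diameter of order `h` and contain boundedly many
elements. -/

theorem evalPoly_apply (P : MvPolynomial (Fin d) ℝ) (x : E d) :
    evalPoly d P x = MvPolynomial.eval (fun i => x i) P := by
  change MvPolynomial.aeval (fun i => x i) P = _
  rw [MvPolynomial.aeval_eq_eval]

theorem mem_polySpace {p : E d → ℝ} :
    p ∈ polySpace d k ↔ ∃ P : MvPolynomial (Fin d) ℝ, P.totalDegree ≤ k ∧ evalPoly d P = p := by
  simp [polySpace, MvPolynomial.mem_restrictTotalDegree]

theorem polySpace_mono {m n : ℕ} (h : m ≤ n) : polySpace d m ≤ polySpace d n := by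
  intro p hp
  obtain ⟨P, hP, rfl⟩ := mem_polySpace.1 hp
  exact mem_polySpace.2 ⟨P, hP.trans h, rfl⟩

theorem mul_mem_polySpace {m n : ℕ} {p q : E d → ℝ} (hp : p ∈ polySpace d m)
    (hq : q ∈ polySpace d n) : p * q ∈ polySpace d (m + n) := by
  obtain ⟨P, hP, rfl⟩ := mem_polySpace.1 hp
  obtain ⟨Q, hQ, rfl⟩ := mem_polySpace.1 hq
  refine mem_polySpace.2 ⟨P * Q, (MvPolynomial.totalDegree_mul P Q).trans (add_le_add hP hQ), ?_⟩
  ext x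
  simp [evalPoly_apply]

theorem const_mem_polySpace (c : ℝ) : (fun _ : E d => c) ∈ polySpace d k :=
  mem_polySpace.2 ⟨MvPolynomial.C c, by simp, by ext x; simp [evalPoly_apply]⟩

theorem coord_mem_polySpace (i : Fin d) : (fun x : E d => x i) ∈ polySpace d 1 :=
  mem_polySpace.2 ⟨MvPolynomial.X i, by simp, by ext x; simp [evalPoly_apply]⟩

theorem affine_mem_polySpace (a : E d →ᵃ[ℝ] ℝ) : (a : E d → ℝ) ∈ polySpace d 1 := by
  have h : (a : E d → ℝ) = (fun _ => a 0) +
      ∑ i, a.linear (EuclideanSpace.single i 1) • fun x : E d => x i := by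
    ext x
    have h1 : a x = a.linear x + a 0 := by
      have := a.map_vadd 0 x
      simpa using this
    have h2 : x = ∑ i, x i • (EuclideanSpace.single i (1 : ℝ) : E d) := by
      have := (EuclideanSpace.basisFun (Fin d) ℝ).sum_repr x
      simpa using this.symm
    rw [h1]
    conv_lhs => rw [h2]
    simp [map_sum, mul_comm, add_comm]
  rw [h]
  exact add_mem (const_mem_polySpace _)
    (Submodule.sum_mem _ fun i _ => Submodule.smul_mem _ _ (coord_mem_polySpace i))

theorem prod_pow_mem_polySpace (g : Fin d → E d → ℝ) (hg : ∀ i, g i ∈ polySpace d 1)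
    (s : Fin d →₀ ℕ) : (∏ i, g i ^ s i) ∈ polySpace d (∑ i, s i) := by
  have hpow : ∀ i (n : ℕ), g i ^ n ∈ polySpace d n := by
    intro i n
    induction n with
    | zero => rw [pow_zero]; exact const_mem_polySpace (d := d) (k := 0) 1
    | succ n ih => rw [pow_succ]; exact mul_mem_polySpace ih (hg i)
  have : ∀ t : Finset (Fin d), (∏ i ∈ t, g i ^ s i) ∈ polySpace d (∑ i ∈ t, s i) := by
    classical
    intro t
    induction t using Finset.induction_on with
    | empty => rw [Finset.prod_empty, Finset.sum_empty]; exact const_mem_polySpace (d := d) (k := 0) 1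
    | insert a t ha ih =>
      rw [Finset.prod_insert ha, Finset.sum_insert ha]
      exact mul_mem_polySpace (hpow _ _) ih
  exact this _

theorem evalPoly_eq_sum (P : MvPolynomial (Fin d) ℝ) :
    evalPoly d P = ∑ s ∈ P.support, P.coeff s • ∏ i, (fun x : E d => x i) ^ s i := by
  ext x
  rw [evalPoly_apply, MvPolynomial.eval_eq']
  simp [Finset.sum_apply, Finset.prod_apply]

theorem sum_le_of_mem_support {P : MvPolynomial (Fin d) ℝ} (hP : P.totalDegree ≤ k)
    {s : Fin d →₀ ℕ} (hs : s ∈ P.support) : ∑ i, s i ≤ k := by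
  refine le_trans ?_ hP
  have := MvPolynomial.le_totalDegree hs
  rwa [Finsupp.sum_fintype _ _ (by simp)] at this

/-- Polynomials of degree at most `k` are stable under affine substitutions. -/
theorem comp_affine_mem_polySpace {p : E d → ℝ} (hp : p ∈ polySpace d k)
    (f : E d →ᵃ[ℝ] E d) : (fun x => p (f x)) ∈ polySpace d k := by
  obtain ⟨P, hP, rfl⟩ := mem_polySpace.1 hp
  have hf : ∀ i, (fun x => f x i) ∈ polySpace d 1 := fun i =>
    affine_mem_polySpace (((EuclideanSpace.proj i : E d →L[ℝ] ℝ) : E d →ₗ[ℝ] ℝ).toAffineMap.comp f)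
  have : (fun x => evalPoly d P (f x)) =
      ∑ s ∈ P.support, P.coeff s • ∏ i, (fun x : E d => f x i) ^ s i := by
    ext x
    rw [evalPoly_eq_sum]
    simp [Finset.sum_apply, Finset.prod_apply]
  rw [this]
  exact Submodule.sum_mem _ fun s hs => Submodule.smul_mem _ _
    (polySpace_mono (sum_le_of_mem_support hP hs) (prod_pow_mem_polySpace _ hf s))

theorem contDiff_of_mem_polySpace {p : E d → ℝ} (hp : p ∈ polySpace d k) {n : WithTop ℕ∞} :
    ContDiff ℝ n p := by
  obtain ⟨P, hP, rfl⟩ := mem_polySpace.1 hp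
  have : evalPoly d P = fun x => ∑ s ∈ P.support, P.coeff s • ∏ i, (x i) ^ s i := by
    ext x
    rw [evalPoly_eq_sum]
    simp [Finset.sum_apply, Finset.prod_apply]
  rw [this]
  fun_prop

theorem continuous_of_mem_polySpace {p : E d → ℝ} (hp : p ∈ polySpace d k) : Continuous p :=
  (contDiff_of_mem_polySpace hp (n := 0)).continuous

theorem differentiable_of_mem_polySpace {p : E d → ℝ} (hp : p ∈ polySpace d k) :
    Differentiable ℝ p :=
  (contDiff_of_mem_polySpace hp (n := 1)).differentiable (by norm_num)

/-- Directional derivatives of polynomials of degree at most `k` are such polynomials. -/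
theorem fderiv_apply_mem_polySpace [FiniteDimensional ℝ (polySpace d k)] {p : E d → ℝ}
    (hp : p ∈ polySpace d k) (e : E d) : (fun x => fderiv ℝ p x e) ∈ polySpace d k := by
  -- The derivative is the pointwise limit of difference quotients, which stay in the space by
  -- affine substitution; a finite-dimensional subspace is closed under such limits.
  have hcl : IsClosed (polySpace d k : Set (E d → ℝ)) := Submodule.closed_of_finiteDimensional _
  refine hcl.mem_of_tendsto (b := nhdsWithin (0 : ℝ) {0}ᶜ)
    (f := fun t : ℝ => t⁻¹ • ((fun x => p (x + t • e)) - p)) ?_ ?_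
  · rw [tendsto_pi_nhds]
    intro x
    have h := (differentiable_of_mem_polySpace hp x).hasFDerivAt.hasLineDerivAt e
    have := h.tendsto_slope_zero
    simpa using this
  · refine Filter.Eventually.of_forall fun t => ?_
    refine Submodule.smul_mem _ _ (Submodule.sub_mem _ ?_ hp)
    exact comp_affine_mem_polySpace hp (AffineMap.id ℝ (E d) + AffineMap.const ℝ (E d) (t • e))

/-- The zero set of a nonzero polynomial is a Lebesgue null set. -/
theorem volume_zeroSet_eq_zero {p : E d → ℝ} (hp : p ∈ polySpace d k) (h0 : p ≠ 0) :
    volume {x | p x = 0} = 0 := by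
  obtain ⟨y, hy⟩ : ∃ y, p y ≠ 0 := by
    by_contra! h
    exact h0 (funext h)
  have hc := continuous_of_mem_polySpace hp
  -- On any line through `y` the polynomial is univariate and nonzero at `s = 0`, hence has finitely
  -- many zeros.
  have hline : ∀ x : E d, {s : ℝ | p (y + s • x) = 0}.Finite := by
    intro x
    obtain ⟨P, hP, rfl⟩ := mem_polySpace.1 hp
    let Q : Polynomial ℝ :=
      MvPolynomial.aeval (fun i => Polynomial.C (y i) + Polynomial.C (x i) * Polynomial.X) P
    have hQ : ∀ s : ℝ, Q.eval s = evalPoly d P (y + s • x) := by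
      intro s
      have : Q.eval s = (Polynomial.aeval s) Q := by simp [Polynomial.coe_aeval_eq_eval]
      rw [this, ← AlgHom.comp_apply, MvPolynomial.comp_aeval, evalPoly_apply]
      rw [MvPolynomial.aeval_eq_eval]
      have hf : (fun i => (Polynomial.aeval s)
          (Polynomial.C (y i) + Polynomial.C (x i) * Polynomial.X)) =
          fun i => (y + s • x) i := by
        ext i
        rw [map_add, map_mul, Polynomial.aeval_C, Polynomial.aeval_C, Polynomial.aeval_X]
        exact congrArg (y i + ·) (mul_comm (x i) s)
      rw [hf]
    have hQ0 : Q ≠ 0 := by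
      intro h
      have := hQ 0
      simp [h] at this
      exact hy this.symm
    refine (Polynomial.finite_setOfPred_isRoot hQ0).subset fun s hs => ?_
    simpa [Polynomial.IsRoot, hQ s] using hs
  have hmeas : MeasurableSet {z : E d × ℝ | p (y + z.2 • z.1) = 0} := by
    refine (isClosed_eq ?_ continuous_const).measurableSet
    fun_prop
  -- Fubini in both orders: the slices for fixed direction `x` are finite, so for almost every `s`
  -- the slice in `x` is null. One such `s ≠ 0` suffices, since `x ↦ y + s • x` is then an
  -- invertible affine map.
  have hnull : ((volume : Measure (E d)).prod (volume : Measure ℝ))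
      {z : E d × ℝ | p (y + z.2 • z.1) = 0} = 0 := by
    rw [Measure.measure_prod_null hmeas]
    exact Filter.Eventually.of_forall fun x => (hline x).measure_zero _
  have hnull' : ((volume : Measure ℝ).prod (volume : Measure (E d)))
      (Prod.swap ⁻¹' {z : E d × ℝ | p (y + z.2 • z.1) = 0}) = 0 := by
    rw [Measure.measurePreserving_swap.measure_preimage hmeas.nullMeasurableSet, hnull]
  have hae := Measure.measure_ae_null_of_prod_null hnull'
  obtain ⟨s, hs, hs0⟩ := (hae.and (Measure.ae_ne (volume : Measure ℝ) 0)).exists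
  have hs' : volume ((s • ·) ⁻¹' ((y + ·) ⁻¹' {x | p x = 0})) = 0 := hs
  rw [Measure.addHaar_preimage_smul _ hs0, measure_preimage_add, mul_eq_zero] at hs'
  refine hs'.resolve_left ?_
  have : 0 < |(s ^ Module.finrank ℝ (E d))⁻¹| := by positivity
  simpa using this

/-- If `k ≥ 1`, every polynomial of degree at most `k` is a combination of products of an affine
function and a polynomial of degree at most `k - 1`. -/
theorem polySpace_le_span_mul (hk : 1 ≤ k) :
    polySpace d k ≤ Submodule.span ℝ {f | ∃ a : E d →ᵃ[ℝ] ℝ, ∃ q ∈ polySpace d (k - 1),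
      f = (a : E d → ℝ) * q} := by
  intro p hp
  obtain ⟨P, hP, rfl⟩ := mem_polySpace.1 hp
  rw [evalPoly_eq_sum]
  refine Submodule.sum_mem _ fun s hs => Submodule.smul_mem _ _ (Submodule.subset_span ?_)
  have hdeg := sum_le_of_mem_support hP hs
  by_cases h0 : s = 0
  · refine ⟨AffineMap.const ℝ (E d) 1, fun _ => 1, const_mem_polySpace _, ?_⟩
    subst h0
    ext x
    simp
  · obtain ⟨i, hi⟩ : ∃ i, s i ≠ 0 := by
      by_contra! h
      exact h0 (Finsupp.ext h)
    have hle : Finsupp.single i 1 ≤ s := by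
      rw [Finsupp.single_le_iff]
      omega
    obtain ⟨t, rfl⟩ : ∃ t, s = Finsupp.single i 1 + t := ⟨_, (add_tsub_cancel_of_le hle).symm⟩
    have hsum : ∑ j, (Finsupp.single i 1 + t : Fin d →₀ ℕ) j = 1 + ∑ j, t j := by
      classical
      simp [Finset.sum_add_distrib, Finsupp.single_apply]
    refine ⟨((EuclideanSpace.proj i : E d →L[ℝ] ℝ) : E d →ₗ[ℝ] ℝ).toAffineMap,
      ∏ j, (fun x : E d => x j) ^ t j,
      polySpace_mono (by omega) (prod_pow_mem_polySpace _ (fun j => coord_mem_polySpace j) t), ?_⟩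
    classical
    have h1 : ∏ j, (fun x : E d => x j) ^ (Finsupp.single i 1 : Fin d →₀ ℕ) j =
        fun x : E d => x i := by
      rw [Finset.prod_eq_single i (fun j _ hj => by simp [hj.symm])
        (by simp)]
      simp
    simp only [Finsupp.add_apply, pow_add, Finset.prod_mul_distrib, h1]
    rfl

end

/-! ### Uniform equivalence of coefficient norm and `L²` norm on subsets of a ball. -/

section

variable {d k : ℕ} {A : Type} [Fintype A]

theorem exists_bound_shape (φhat : Module.Basis A ℝ (polySpace d k)) (R : ℝ) :
    ∃ K : ℝ, 0 < K ∧ ∀ a, ∀ x ∈ Metric.closedBall (0 : E d) R,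
      |(φhat a : E d → ℝ) x| ≤ K ∧ ‖fderiv ℝ (φhat a : E d → ℝ) x‖ ≤ K := by
  have h1 : ∀ a, ∃ K : ℝ, ∀ x ∈ Metric.closedBall (0 : E d) R,
      |(φhat a : E d → ℝ) x| ≤ K ∧ ‖fderiv ℝ (φhat a : E d → ℝ) x‖ ≤ K := by
    intro a
    have hc : IsCompact (Metric.closedBall (0 : E d) R) := isCompact_closedBall _ _
    obtain ⟨K1, hK1⟩ := hc.exists_bound_of_continuousOn
      (continuous_of_mem_polySpace (φhat a).2).continuousOn
    obtain ⟨K2, hK2⟩ := hc.exists_bound_of_continuousOn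
      ((contDiff_of_mem_polySpace (φhat a).2 (n := 1)).continuous_fderiv (by norm_num)).continuousOn
    exact ⟨max K1 K2, fun x hx => ⟨(hK1 x hx).trans (le_max_left _ _),
      (hK2 x hx).trans (le_max_right _ _)⟩⟩
  choose K hK using h1
  refine ⟨1 + ∑ a, |K a|, by positivity, fun a x hx => ?_⟩
  have h2 : K a ≤ 1 + ∑ a, |K a| := by
    have := Finset.single_le_sum (f := fun a => |K a|) (fun _ _ => abs_nonneg _) (Finset.mem_univ a)
    have h3 := le_abs_self (K a)
    linarith
  exact ⟨(hK a x hx).1.trans h2, (hK a x hx).2.trans h2⟩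

theorem equivFun_symm_coe (φhat : Module.Basis A ℝ (polySpace d k)) (c : A → ℝ) :
    (φhat.equivFun.symm c : E d → ℝ) = ∑ a, c a • (φhat a : E d → ℝ) := by
  simp [Module.Basis.equivFun_symm_apply]

theorem abs_combination_le (φhat : Module.Basis A ℝ (polySpace d k)) {K : ℝ} {x : E d}
    (hK : ∀ a, |(φhat a : E d → ℝ) x| ≤ K) (c : A → ℝ) :
    |(φhat.equivFun.symm c : E d → ℝ) x| ≤ Fintype.card A * K * ‖c‖ := by
  rw [equivFun_symm_coe, Finset.sum_apply]
  calc |∑ a, (c a • (φhat a : E d → ℝ)) x| ≤ ∑ a, |(c a • (φhat a : E d → ℝ)) x| :=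
        Finset.abs_sum_le_sum_abs _ _
    _ ≤ ∑ _a : A, ‖c‖ * K := by
        refine Finset.sum_le_sum fun a _ => ?_
        rw [Pi.smul_apply, smul_eq_mul, abs_mul]
        exact mul_le_mul (norm_le_pi_norm c a) (hK a) (abs_nonneg _) (norm_nonneg _)
    _ = _ := by simp; ring

theorem norm_fderiv_combination_le (φhat : Module.Basis A ℝ (polySpace d k)) {K : ℝ} {x : E d}
    (hK : ∀ a, ‖fderiv ℝ (φhat a : E d → ℝ) x‖ ≤ K) (c : A → ℝ) :
    ‖fderiv ℝ (φhat.equivFun.symm c : E d → ℝ) x‖ ≤ Fintype.card A * K * ‖c‖ := by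
  have h : fderiv ℝ (φhat.equivFun.symm c : E d → ℝ) x =
      ∑ a, c a • fderiv ℝ (φhat a : E d → ℝ) x := by
    rw [equivFun_symm_coe, fderiv_sum fun a _ =>
      ((differentiable_of_mem_polySpace (φhat a).2) x).const_smul (c a)]
    exact Finset.sum_congr rfl fun a _ =>
      fderiv_const_smul ((differentiable_of_mem_polySpace (φhat a).2) x) (c a)
  rw [h]
  calc ‖∑ a, c a • fderiv ℝ (φhat a : E d → ℝ) x‖
      ≤ ∑ a, ‖c a • fderiv ℝ (φhat a : E d → ℝ) x‖ := norm_sum_le _ _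
    _ ≤ ∑ _a : A, ‖c‖ * K := by
        refine Finset.sum_le_sum fun a _ => ?_
        rw [norm_smul]
        exact mul_le_mul (norm_le_pi_norm c a) (hK a) (norm_nonneg _) (norm_nonneg _)
    _ = _ := by simp; ring

/-- A nonzero polynomial is small only on small subsets of a ball. -/
theorem exists_volume_sublevel_le {p : E d → ℝ} (hp : p ∈ polySpace d k) (h0 : p ≠ 0)
    (R : ℝ) {m : ℝ} (hm : 0 < m) :
    ∃ δ : ℝ, 0 < δ ∧ volume.real (Metric.closedBall (0 : E d) R ∩ {x | |p x| ≤ δ}) ≤ m := by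
  have hpc := continuous_of_mem_polySpace hp
  let s : ℕ → Set (E d) := fun n => Metric.closedBall (0 : E d) R ∩ {x | |p x| ≤ 1 / ((n : ℝ) + 1)}
  -- Continuity from above: within the ball, the sublevel sets decrease to the null zero set of `p`.
  have hs : Filter.Tendsto (fun n => volume (s n)) Filter.atTop (nhds (volume (⋂ n, s n))) := by
    refine tendsto_measure_iInter_atTop (fun n => ?_) (fun a b hab => ?_) ⟨0, ?_⟩
    · exact ((Metric.isClosed_closedBall).inter
        (isClosed_le hpc.abs continuous_const)).measurableSet.nullMeasurableSet
    · refine Set.inter_subset_inter_right _ fun x (hx : |p x| ≤ _) => ?_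
      exact hx.trans (one_div_le_one_div_of_le (by positivity) (by exact_mod_cast Nat.succ_le_succ hab))
    · exact ((measure_mono Set.inter_subset_left).trans_lt measure_closedBall_lt_top).ne
  have hz : volume (⋂ n, s n) = 0 := by
    refine measure_mono_null (fun x hx => ?_) (volume_zeroSet_eq_zero hp h0)
    have h1 : ∀ n : ℕ, |p x| ≤ 1 / ((n : ℝ) + 1) := fun n => (Set.mem_iInter.1 hx n).2
    have h2 : |p x| ≤ 0 := ge_of_tendsto' tendsto_one_div_add_atTop_nhds_zero_nat h1
    exact abs_nonpos_iff.1 h2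
  rw [hz] at hs
  obtain ⟨n, hn⟩ := (hs.eventually (gt_mem_nhds (ENNReal.ofReal_pos.2 hm))).exists
  refine ⟨1 / ((n : ℝ) + 1), by positivity, ?_⟩
  exact ENNReal.toReal_le_of_le_ofReal hm.le hn.le

theorem integrableOn_of_continuous_of_subset {f : E d → ℝ} (hf : Continuous f) {s : Set (E d)}
    {z : E d} {R : ℝ} (hs : s ⊆ Metric.closedBall z R) : IntegrableOn f s :=
  (hf.continuousOn.integrableOn_compact (isCompact_closedBall z R)).mono_set hs

/-- The coefficients of a polynomial are controlled by its `L²` norm on any subset of a fixed ball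
whose volume is bounded from below. -/
theorem exists_coeff_sq_le (φhat : Module.Basis A ℝ (polySpace d k)) (R : ℝ) {m : ℝ}
    (hm : 0 < m) :
    ∃ C : ℝ, 0 < C ∧ ∀ s ⊆ Metric.closedBall (0 : E d) R, MeasurableSet s → m ≤ volume.real s →
      ∀ c : A → ℝ, ‖c‖ ^ 2 ≤ C * ∫ x in s, (φhat.equivFun.symm c : E d → ℝ) x ^ 2 := by
  obtain ⟨K, hK, hKb⟩ := exists_bound_shape φhat R
  have key : ∃ ε : ℝ, 0 < ε ∧ ∀ c ∈ Metric.sphere (0 : A → ℝ) 1,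
      ∀ s ⊆ Metric.closedBall (0 : E d) R, MeasurableSet s → m ≤ volume.real s →
      ε ≤ ∫ x in s, (φhat.equivFun.symm c : E d → ℝ) x ^ 2 := by
    -- The set `s` varies in a family without useful compactness, so compactness is used only for
    -- the coefficients: a lower bound valid near each `c₀`, for all `s` at once, is enough.
    refine (isCompact_sphere (0 : A → ℝ) 1).induction_on
      (p := fun S => ∃ ε : ℝ, 0 < ε ∧ ∀ c ∈ S,
        ∀ s ⊆ Metric.closedBall (0 : E d) R, MeasurableSet s → m ≤ volume.real s →
        ε ≤ ∫ x in s, (φhat.equivFun.symm c : E d → ℝ) x ^ 2)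
      ⟨1, one_pos, by simp⟩ ?_ ?_ ?_
    · rintro S T hST ⟨ε, hε, h⟩
      exact ⟨ε, hε, fun c hc => h c (hST hc)⟩
    · rintro S T ⟨ε, hε, h⟩ ⟨ε', hε', h'⟩
      refine ⟨min ε ε', lt_min hε hε', fun c hc s hs hsm hms => ?_⟩
      rcases hc with hc | hc
      · exact (min_le_left _ _).trans (h c hc s hs hsm hms)
      · exact (min_le_right _ _).trans (h' c hc s hs hsm hms)
    · intro c₀ hc₀
      have hne : (φhat.equivFun.symm c₀ : E d → ℝ) ≠ 0 := by
        intro h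
        have h1 : φhat.equivFun.symm c₀ = 0 := Subtype.ext h
        have h2 : c₀ = 0 := φhat.equivFun.symm.map_eq_zero_iff.1 h1
        simp [h2] at hc₀
      obtain ⟨δ, hδ, hvol⟩ := exists_volume_sublevel_le (φhat.equivFun.symm c₀).2 hne R
        (half_pos hm)
      -- The radius `δ / (2 * L)` keeps the perturbed polynomial within `δ / 2` of `p` on the ball.
      -- Outside the sublevel set `Z`, of volume at most `m / 2`, it thus has modulus at least `δ /
      -- 2`, and at least volume `m / 2` of `s` lies there.
      set L : ℝ := Fintype.card A * K + 1
      have hL : 0 < L := by positivity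
      refine ⟨Metric.ball c₀ (δ / (2 * L)), mem_nhdsWithin_of_mem_nhds
        (Metric.ball_mem_nhds _ (by positivity)), (δ / 2) ^ 2 * (m / 2), by positivity, ?_⟩
      intro c hc s hs hsm hms
      set q : E d → ℝ := (φhat.equivFun.symm c : E d → ℝ)
      set p : E d → ℝ := (φhat.equivFun.symm c₀ : E d → ℝ)
      have hqc : Continuous q := continuous_of_mem_polySpace (φhat.equivFun.symm c).2
      have hpc : Continuous p := continuous_of_mem_polySpace (φhat.equivFun.symm c₀).2
      have hdiff : ∀ x ∈ Metric.closedBall (0 : E d) R, |p x - q x| ≤ δ / 2 := by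
        intro x hx
        have h1 := abs_combination_le φhat (fun a => (hKb a x hx).1) (c₀ - c)
        rw [map_sub] at h1
        have h2 : ‖c₀ - c‖ < δ / (2 * L) := by
          rw [← dist_eq_norm, dist_comm]
          exact hc
        have h3 : Fintype.card A * K * ‖c₀ - c‖ ≤ L * (δ / (2 * L)) :=
          mul_le_mul (by simp [L]) h2.le (norm_nonneg _) hL.le
        have h4 : L * (δ / (2 * L)) = δ / 2 := by field_simp
        exact h1.trans (h3.trans h4.le)
      set Z : Set (E d) := Metric.closedBall (0 : E d) R ∩ {x | |p x| ≤ δ}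
      have hZm : MeasurableSet Z :=
        (Metric.isClosed_closedBall.inter (isClosed_le hpc.abs continuous_const)).measurableSet
      have hsfin : volume s ≠ ⊤ := ((measure_mono hs).trans_lt measure_closedBall_lt_top).ne
      have hZfin : volume Z ≠ ⊤ :=
        ((measure_mono Set.inter_subset_left).trans_lt measure_closedBall_lt_top).ne
      have hvol2 : m / 2 ≤ volume.real (s \ Z) := by
        have := le_measureReal_sdiff (μ := volume) (s₁ := s) (s₂ := Z) hZfin
        linarith
      have hint : IntegrableOn (fun x => q x ^ 2) s :=
        integrableOn_of_continuous_of_subset (hqc.pow 2) hs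
      calc (δ / 2) ^ 2 * (m / 2) ≤ (δ / 2) ^ 2 * volume.real (s \ Z) := by gcongr
        _ = ∫ x in s \ Z, (δ / 2) ^ 2 := by simp [mul_comm]
        _ ≤ ∫ x in s \ Z, q x ^ 2 := by
          refine setIntegral_mono_on ?_ (hint.mono_set Set.sdiff_subset) (hsm.diff hZm) ?_
          · exact integrableOn_const (((measure_mono Set.sdiff_subset).trans_lt
              (lt_top_iff_ne_top.2 hsfin)).ne)
          · intro x hx
            have hxb := hs hx.1
            have h1 : δ < |p x| := by
              by_contra! h
              exact hx.2 ⟨hxb, h⟩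
            have h2 := hdiff x hxb
            have h3 : |p x| ≤ |p x - q x| + |q x| := by
              simpa using abs_add_le (p x - q x) (q x)
            rw [← sq_abs (q x)]
            gcongr
            linarith
        _ ≤ ∫ x in s, q x ^ 2 :=
          setIntegral_mono_set hint (Filter.Eventually.of_forall fun x => sq_nonneg _)
            (LE.le.eventuallyLE Set.sdiff_subset)
  obtain ⟨ε, hε, hkey⟩ := key
  refine ⟨ε⁻¹, inv_pos.2 hε, fun s hs hsm hms c => ?_⟩
  rcases eq_or_ne c 0 with rfl | hc
  · simp
  · have hn : 0 < ‖c‖ := norm_pos_iff.2 hc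
    -- Both sides are homogeneous of degree two, so the bound on the unit sphere extends to all
    -- coefficients.
    have h1 := hkey (‖c‖⁻¹ • c) (by simp [norm_smul, hn.ne']) s hs hsm hms
    have h2 : ∀ x, (φhat.equivFun.symm (‖c‖⁻¹ • c) : E d → ℝ) x ^ 2 =
        (‖c‖ ^ 2)⁻¹ * (φhat.equivFun.symm c : E d → ℝ) x ^ 2 := by
      intro x
      rw [map_smul]
      simp [mul_pow]
    simp_rw [h2] at h1
    rw [integral_const_mul] at h1
    rw [inv_mul_eq_div, le_div_iff₀ hε]
    rw [inv_mul_eq_div, le_div_iff₀ (by positivity)] at h1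
    linarith

end

/-! ### Scaled polynomial inequalities on balls of radius comparable to `h`. -/

section

variable {d k : ℕ} {A : Type} [Fintype A]

theorem setIntegral_rescale (f : E d → ℝ) {s : Set (E d)} (hs : MeasurableSet s) (z : E d)
    {h : ℝ} (hh : 0 < h) :
    ∫ x in s, f x = h ^ d * ∫ y in (fun y => z + h • y) ⁻¹' s, f (z + h • y) := by
  have hm : MeasurableSet ((fun y : E d => z + h • y) ⁻¹' s) :=
    (show Continuous fun y : E d => z + h • y by fun_prop).measurable hs
  rw [← integral_indicator hs, ← integral_indicator hm]
  have h1 := Measure.integral_comp_smul (volume : Measure (E d)) (fun y => s.indicator f (z + y)) h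
  rw [integral_add_left_eq_self (fun y => s.indicator f y) z] at h1
  have h2 : ∀ y : E d, ((fun y => z + h • y) ⁻¹' s).indicator (fun y => f (z + h • y)) y =
      s.indicator f (z + h • y) := fun y => rfl
  simp_rw [h2, h1]
  have h3 : 0 < (h ^ d)⁻¹ := by positivity
  rw [finrank_euclideanSpace_fin, abs_of_pos h3, smul_eq_mul, mul_inv_cancel_left₀ (by positivity)]

theorem volume_real_rescale {s : Set (E d)} (hs : MeasurableSet s) (z : E d)
    {h : ℝ} (hh : 0 < h) :
    volume.real s = h ^ d * volume.real ((fun y : E d => z + h • y) ⁻¹' s) := by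
  have := setIntegral_rescale (fun _ => 1) hs z hh
  simpa using this

theorem gradient_apply (p : E d → ℝ) (x : E d) (j : Fin d) :
    gradient p x j = fderiv ℝ p x (EuclideanSpace.single j 1) := by
  rw [gradient]
  have := InnerProductSpace.toDual_symm_apply (𝕜 := ℝ) (x := EuclideanSpace.single j (1 : ℝ))
    (y := fderiv ℝ p x)
  rw [← this, EuclideanSpace.inner_single_right]
  simp

theorem norm_gradient (p : E d → ℝ) (x : E d) : ‖gradient p x‖ = ‖fderiv ℝ p x‖ := by
  rw [gradient, LinearIsometryEquiv.norm_map]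

theorem norm_gradient_sq (p : E d → ℝ) (x : E d) :
    ‖gradient p x‖ ^ 2 = ∑ j, (fderiv ℝ p x (EuclideanSpace.single j 1)) ^ 2 := by
  rw [EuclideanSpace.norm_sq_eq]
  simp [gradient_apply]

/-- Scaled `L^∞`-`L²` and inverse inequalities for polynomials: on a ball of radius `R * h`, the
values and the first derivatives are controlled by the `L²` norm on a subset of volume at least
`m * h ^ d`. -/
theorem exists_sup_le_integral (φhat : Module.Basis A ℝ (polySpace d k)) (R : ℝ) {m : ℝ}
    (hm : 0 < m) :
    ∃ C : ℝ, 0 < C ∧ ∀ (h : ℝ) (z : E d) (s : Set (E d)), 0 < h →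
      s ⊆ Metric.closedBall z (R * h) → MeasurableSet s → m * h ^ d ≤ volume.real s →
      ∀ p ∈ polySpace d k, ∀ x ∈ Metric.closedBall z (R * h),
        h ^ d * p x ^ 2 ≤ C * ∫ y in s, p y ^ 2 ∧
        h ^ d * (h * ‖gradient p x‖) ^ 2 ≤ C * ∫ y in s, p y ^ 2 := by
  obtain ⟨C, hC, hcoef⟩ := exists_coeff_sq_le φhat R hm
  obtain ⟨K, hK, hKb⟩ := exists_bound_shape φhat R
  set L : ℝ := Fintype.card A * K + 1
  have hL : 0 < L := by positivity
  have hLL : Fintype.card A * K ≤ L := by simp [L]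
  refine ⟨L ^ 2 * C, by positivity, fun h z s hh hs hsm hms p hp x hx => ?_⟩
  -- Pulling back by `y ↦ z + h • y` reduces to unit scale: the volume bound becomes `m`, and the
  -- chain rule produces the factor `h` in front of the gradient.
  let f : E d →ᵃ[ℝ] E d := AffineMap.const ℝ (E d) z + (h • LinearMap.id (R := ℝ) (M := E d)).toAffineMap
  have hf : ∀ y, f y = z + h • y := fun y => rfl
  have hq := comp_affine_mem_polySpace hp f
  obtain ⟨c, hc⟩ := φhat.equivFun.symm.surjective ⟨_, hq⟩
  have hcq : (φhat.equivFun.symm c : E d → ℝ) = fun y => p (z + h • y) := by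
    rw [hc]
    rfl
  have hsub : (fun y : E d => z + h • y) ⁻¹' s ⊆ Metric.closedBall (0 : E d) R := by
    intro y hy
    have h1 := hs hy
    rw [Metric.mem_closedBall, dist_eq_norm, add_sub_cancel_left, norm_smul, Real.norm_eq_abs,
      abs_of_pos hh, mul_comm R] at h1
    rw [mem_closedBall_zero_iff]
    exact le_of_mul_le_mul_left h1 hh
  have hm' : MeasurableSet ((fun y : E d => z + h • y) ⁻¹' s) :=
    (show Continuous fun y : E d => z + h • y by fun_prop).measurable hsm
  have hhd : 0 < h ^ d := by positivity
  have hvol : m ≤ volume.real ((fun y : E d => z + h • y) ⁻¹' s) := by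
    rw [volume_real_rescale hsm z hh, mul_comm m] at hms
    exact le_of_mul_le_mul_left hms hhd
  have hco := hcoef _ hsub hm' hvol c
  rw [setIntegral_rescale (fun x => p x ^ 2) hsm z hh]
  set J := ∫ y in (fun y => z + h • y) ⁻¹' s, p (z + h • y) ^ 2
  rw [hcq] at hco
  change ‖c‖ ^ 2 ≤ C * J at hco
  set y : E d := h⁻¹ • (x - z)
  have hxy : x = z + h • y := by simp [y, smul_smul, hh.ne']
  have hy : y ∈ Metric.closedBall (0 : E d) R := by
    rw [mem_closedBall_zero_iff, norm_smul, norm_inv, Real.norm_eq_abs, abs_of_pos hh,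
      inv_mul_le_iff₀ hh, ← dist_eq_norm, mul_comm]
    exact hx
  have h1 := abs_combination_le φhat (fun a => (hKb a y hy).1) c
  have h2 := norm_fderiv_combination_le φhat (fun a => (hKb a y hy).2) c
  have hder : fderiv ℝ (φhat.equivFun.symm c : E d → ℝ) y = h • fderiv ℝ p x := by
    rw [hcq, hxy]
    have hd1 : HasFDerivAt (fun y : E d => z + h • y) (h • ContinuousLinearMap.id ℝ (E d)) y :=
      ((hasFDerivAt_id y).const_smul h).const_add z
    have hd2 := (differentiable_of_mem_polySpace hp (z + h • y)).hasFDerivAt.comp y hd1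
    rw [show (fun y => p (z + h • y)) = p ∘ fun y => z + h • y from rfl, hd2.fderiv]
    ext v
    simp
  rw [hder, norm_smul, Real.norm_eq_abs, abs_of_pos hh, ← norm_gradient] at h2
  rw [hcq] at h1
  simp only [← hxy] at h1
  have hfin : ∀ t : ℝ, 0 ≤ t → t ≤ Fintype.card A * K * ‖c‖ →
      h ^ d * t ^ 2 ≤ L ^ 2 * C * (h ^ d * J) := by
    intro t ht0 ht
    have h3 : t ≤ L * ‖c‖ := ht.trans (mul_le_mul_of_nonneg_right hLL (norm_nonneg _))
    calc h ^ d * t ^ 2 ≤ h ^ d * (L * ‖c‖) ^ 2 := by gcongr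
      _ = h ^ d * L ^ 2 * ‖c‖ ^ 2 := by ring
      _ ≤ h ^ d * L ^ 2 * (C * J) := by gcongr
      _ = _ := by ring
  refine ⟨?_, hfin _ (by positivity) h2⟩
  rw [← sq_abs]
  exact hfin _ (abs_nonneg _) h1

/-- Scaled `L^∞`-`L²` inequality for the gradient. -/
theorem exists_gradient_sup_le_integral (φhat : Module.Basis A ℝ (polySpace d k)) (R : ℝ) {m : ℝ}
    (hm : 0 < m) :
    ∃ C : ℝ, 0 < C ∧ ∀ (h : ℝ) (z : E d) (s : Set (E d)), 0 < h →
      s ⊆ Metric.closedBall z (R * h) → MeasurableSet s → m * h ^ d ≤ volume.real s →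
      ∀ p ∈ polySpace d k, ∀ x ∈ Metric.closedBall z (R * h),
        h ^ d * ‖gradient p x‖ ^ 2 ≤ C * ∫ y in s, ‖gradient p y‖ ^ 2 := by
  have : FiniteDimensional ℝ (polySpace d k) := φhat.finiteDimensional_of_finite
  -- The value bound applies to each partial derivative, again a polynomial of degree at most `k`,
  -- with the same constant.
  obtain ⟨C, hC, hsup⟩ := exists_sup_le_integral φhat R hm
  refine ⟨C, hC, fun h z s hh hs hsm hms p hp x hx => ?_⟩
  simp_rw [norm_gradient_sq]
  rw [integral_finsetSum, Finset.mul_sum, Finset.mul_sum]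
  · exact Finset.sum_le_sum fun j _ =>
      (hsup h z s hh hs hsm hms _ (fderiv_apply_mem_polySpace hp _) x hx).1
  · intro j _
    exact integrableOn_of_continuous_of_subset
      ((continuous_of_mem_polySpace (fderiv_apply_mem_polySpace hp _)).pow 2) hs

/-- Polynomial extension from a subset of volume at least `m * h ^ d`, in the maximum norm, and the
corresponding inverse inequality. -/
theorem exists_sup_le_sup (φhat : Module.Basis A ℝ (polySpace d k)) (R : ℝ) {m : ℝ}
    (hm : 0 < m) :
    ∃ C : ℝ, 0 < C ∧ ∀ (h : ℝ) (z : E d) (s : Set (E d)), 0 < h →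
      s ⊆ Metric.closedBall z (R * h) → MeasurableSet s → m * h ^ d ≤ volume.real s →
      ∀ p ∈ polySpace d k, ∀ B : ℝ, (∀ y ∈ s, |p y| ≤ B) → ∀ x ∈ Metric.closedBall z (R * h),
        |p x| ≤ C * B ∧ h * ‖gradient p x‖ ≤ C * B := by
  obtain ⟨C, hC, hsup⟩ := exists_sup_le_integral φhat R hm
  set ω : ℝ := volume.real (Metric.closedBall (0 : E d) R) + 1
  have hω : 0 < ω := by positivity
  refine ⟨Real.sqrt (C * ω), by positivity, fun h z s hh hs hsm hms p hp B hB x hx => ?_⟩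
  have hhd : 0 < h ^ d := by positivity
  have hsfin : volume s < ⊤ := (measure_mono hs).trans_lt measure_closedBall_lt_top
  have hspos : 0 < volume.real s := lt_of_lt_of_le (by positivity) hms
  have hB0 : 0 ≤ B := by
    rcases s.eq_empty_or_nonempty with rfl | ⟨y, hy⟩
    · simp at hspos
    · exact (abs_nonneg _).trans (hB y hy)
  have hvol : volume.real s ≤ ω * h ^ d := by
    refine (measureReal_mono hs measure_closedBall_lt_top.ne).trans ?_
    rw [volume_real_rescale (d := d) Metric.isClosed_closedBall.measurableSet z hh, mul_comm]
    refine mul_le_mul_of_nonneg_right ?_ hhd.le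
    have h1 : (fun y : E d => z + h • y) ⁻¹' Metric.closedBall z (R * h) =
        Metric.closedBall (0 : E d) R := by
      ext y
      rw [Set.mem_preimage, Metric.mem_closedBall, dist_eq_norm, add_sub_cancel_left, norm_smul,
        Real.norm_eq_abs, abs_of_pos hh, mem_closedBall_zero_iff, mul_comm R,
        mul_le_mul_iff_right₀ hh]
    rw [h1]
    simp [ω]
  have hint : ∫ y in s, p y ^ 2 ≤ ω * h ^ d * B ^ 2 := by
    calc ∫ y in s, p y ^ 2 ≤ ∫ y in s, B ^ 2 := by
          refine setIntegral_mono_on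
            (integrableOn_of_continuous_of_subset ((continuous_of_mem_polySpace hp).pow 2) hs)
            (integrableOn_const hsfin.ne) hsm fun y hy => ?_
          rw [← sq_abs]
          exact pow_le_pow_left₀ (abs_nonneg _) (hB y hy) 2
      _ = volume.real s * B ^ 2 := by simp
      _ ≤ _ := by gcongr
  obtain ⟨h1, h2⟩ := hsup h z s hh hs hsm hms p hp x hx
  have hfin : ∀ t : ℝ, h ^ d * t ^ 2 ≤ C * ∫ y in s, p y ^ 2 → |t| ≤ Real.sqrt (C * ω) * B := by
    intro t ht
    have h3 : h ^ d * t ^ 2 ≤ h ^ d * (C * ω * B ^ 2) := by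
      calc h ^ d * t ^ 2 ≤ C * (ω * h ^ d * B ^ 2) := ht.trans (by gcongr)
        _ = _ := by ring
    have h4 := le_of_mul_le_mul_left h3 hhd
    refine abs_le_of_sq_le_sq ?_ (by positivity)
    rw [mul_pow, Real.sq_sqrt (by positivity)]
    exact h4
  exact ⟨hfin _ h1, (le_abs_self _).trans (hfin _ h2)⟩

end

/-! ### Geometry of simplicial meshes: hat functions, element counting, paths. -/

section

variable {d k : ℕ}

theorem Mesh.finite_elements (M : Mesh d) : M.elements.Finite :=
  M.finite_faces.subset fun _ hT => hT.1

theorem isCompact_body (T : Finset (E d)) : IsCompact (body T) :=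
  T.finite_toSet.isCompact_convexHull (𝕜 := ℝ)

theorem measurableSet_body (T : Finset (E d)) : MeasurableSet (body T) :=
  (isCompact_body T).isClosed.measurableSet

theorem mem_body {T : Finset (E d)} {x : E d} (hx : x ∈ T) : x ∈ body T :=
  subset_convexHull ℝ _ hx

/-- Barycentric coordinates of an element, extended by zero to the other points. -/
theorem exists_barycentric {M : Mesh d} {T : Finset (E d)} (hT : T ∈ M.elements) :
    ∃ l : E d → (E d →ᵃ[ℝ] ℝ), (∀ x ∉ T, l x = 0) ∧
      (∀ z ∈ T, ∀ x, (x = z → l x z = 1) ∧ (x ≠ z → l x z = 0)) ∧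
      ∀ (a : E d →ᵃ[ℝ] ℝ) (y : E d), a y = ∑ x ∈ T, a x * l x y := by
  classical
  have hi : AffineIndependent ℝ ((↑) : T → E d) := M.cplx.indep hT.1
  have hspan : affineSpan ℝ (Set.range ((↑) : T → E d)) = ⊤ := by
    rw [hi.affineSpan_eq_top_iff_card_eq_finrank_add_one]
    simp [hT.2]
  let b : AffineBasis T ℝ (E d) := ⟨(↑), hi, hspan⟩
  have hb : ∀ i : T, b i = i := fun i => rfl
  refine ⟨fun x => if hx : x ∈ T then b.coord ⟨x, hx⟩ else 0, fun x hx => dif_neg hx,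
    fun z hz x => ⟨?_, ?_⟩, fun a y => ?_⟩
  · rintro rfl
    simp only [hz, dif_pos]
    exact b.coord_apply_eq ⟨x, hz⟩
  · intro hxz
    by_cases hx : x ∈ T
    · simp only [hx, dif_pos]
      exact b.coord_apply_ne (i := ⟨x, hx⟩) (j := ⟨z, hz⟩) (by simpa using hxz)
    · simp [hx]
  · have h1 : a y = ∑ i : T, b.coord i y * a (b i) := by
      have h2 := b.affineCombination_coord_eq_self y
      conv_lhs => rw [← h2]
      rw [Finset.map_affineCombination _ _ _ (b.sum_coord_apply_eq_one y),
        Finset.affineCombination_eq_linear_combination _ _ _ (b.sum_coord_apply_eq_one y)]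
      simp
    rw [h1, ← Finset.sum_coe_sort T]
    refine Finset.sum_congr rfl fun i _ => ?_
    simp [hb, mul_comm]

open Classical in
/-- The barycentric coordinate of the element `T` at the vertex `x`. -/
noncomputable def baryCoord (M : Mesh d) (T : Finset (E d)) : E d → (E d →ᵃ[ℝ] ℝ) :=
  if hT : T ∈ M.elements then (exists_barycentric hT).choose else 0

theorem baryCoord_spec {M : Mesh d} {T : Finset (E d)} (hT : T ∈ M.elements) :
    (∀ x ∉ T, baryCoord M T x = 0) ∧
      (∀ z ∈ T, ∀ x, (x = z → baryCoord M T x z = 1) ∧ (x ≠ z → baryCoord M T x z = 0)) ∧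
      ∀ (a : E d →ᵃ[ℝ] ℝ) (y : E d), a y = ∑ x ∈ T, a x * baryCoord M T x y := by
  rw [baryCoord, dif_pos hT]
  exact (exists_barycentric hT).choose_spec

theorem convex_zeroSet_affine (a : E d →ᵃ[ℝ] ℝ) : Convex ℝ {y | a y = 0} := by
  have : {y | a y = 0} = a ⁻¹' {0} := rfl
  rw [this]
  exact (convex_singleton (0 : ℝ)).affine_preimage a

/-- Conformity: two elements meet inside the convex hull of their common vertices, and there the two
affine functions agree because they agree at those vertices. Extending the coordinates by zero to
non-vertices lets `x` be arbitrary. -/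
theorem baryCoord_eq {M : Mesh d} {T T' : Finset (E d)} (hT : T ∈ M.elements)
    (hT' : T' ∈ M.elements) {y : E d} (hy : y ∈ body T) (hy' : y ∈ body T') (x : E d) :
    baryCoord M T x y = baryCoord M T' x y := by
  have h1 := M.cplx.inter_subset_convexHull hT.1 hT'.1 ⟨hy, hy'⟩
  have h2 : convexHull ℝ ((T : Set (E d)) ∩ T') ⊆
      {y | (baryCoord M T x - baryCoord M T' x) y = 0} := by
    refine convexHull_min (fun z hz => ?_) (convex_zeroSet_affine _)
    have h3 := (baryCoord_spec hT).2.1 z hz.1 x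
    have h4 := (baryCoord_spec hT').2.1 z hz.2 x
    change baryCoord M T x z - baryCoord M T' x z = 0
    by_cases h : x = z
    · rw [h3.1 h, h4.1 h, sub_self]
    · rw [h3.2 h, h4.2 h, sub_self]
  exact sub_eq_zero.1 (h2 h1)

open Classical in
/-- The global continuous piecewise affine hat function of the vertex `x`. -/
noncomputable def hatFun (M : Mesh d) (x : E d) (y : E d) : ℝ :=
  if h : ∃ T ∈ M.elements, y ∈ body T then baryCoord M h.choose x y else 0

theorem hatFun_eq {M : Mesh d} {T : Finset (E d)} (hT : T ∈ M.elements) {y : E d}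
    (hy : y ∈ body T) (x : E d) : hatFun M x y = baryCoord M T x y := by
  have h : ∃ T ∈ M.elements, y ∈ body T := ⟨T, hT, hy⟩
  rw [hatFun, dif_pos h]
  exact baryCoord_eq h.choose_spec.1 hT h.choose_spec.2 hy x

theorem Mesh.mem_domain_iff {M : Mesh d} {y : E d} :
    y ∈ M.domain ↔ ∃ T ∈ M.elements, y ∈ body T := by
  rw [Mesh.domain, Geometry.SimplicialComplex.mem_space_iff]
  constructor
  · rintro ⟨s, hs, hy⟩
    obtain ⟨t, ht, hst, hcard⟩ := M.pure s hs
    exact ⟨t, ⟨ht, hcard⟩, convexHull_mono (by exact_mod_cast hst) hy⟩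
  · rintro ⟨T, hT, hy⟩
    exact ⟨T, hT.1, hy⟩

theorem continuous_affineMap (a : E d →ᵃ[ℝ] ℝ) : Continuous a :=
  a.continuous_of_finiteDimensional

theorem continuousOn_hatFun (M : Mesh d) (x : E d) : ContinuousOn (hatFun M x) M.domain := by
  have hfin : Finite M.elements := M.finite_elements
  have h1 : M.domain = ⋃ T : M.elements, body (T : Finset (E d)) := by
    ext y
    simp [Mesh.mem_domain_iff]
  rw [h1]
  refine (locallyFinite_of_finite _).continuousOn_iUnion
    (fun T => (isCompact_body _).isClosed) fun T => ?_
  exact (continuous_affineMap (baryCoord M T x)).continuousOn.congr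
    fun y hy => hatFun_eq T.2 hy x

theorem hatFun_mul_mem_bgSpace (hk : 1 ≤ k) (M : Mesh d) (x : E d) {q : E d → ℝ}
    (hq : q ∈ polySpace d (k - 1)) : hatFun M x * q ∈ bgSpace M k := by
  refine ⟨(continuousOn_hatFun M x).mul (continuous_of_mem_polySpace hq).continuousOn,
    fun T hT => ⟨baryCoord M T x * q, ?_, fun y hy => ?_⟩⟩
  · have := mul_mem_polySpace (affine_mem_polySpace (baryCoord M T x)) hq
    rwa [Nat.add_sub_cancel' hk] at this
  · change hatFun M x y * q y = baryCoord M T x y * q y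
    rw [hatFun_eq hT hy]

theorem one_mem_bgSpace (M : Mesh d) : (fun _ => (1 : ℝ)) ∈ bgSpace M k :=
  ⟨continuousOn_const, fun _ _ => ⟨_, const_mem_polySpace 1, fun _ _ => rfl⟩⟩

/-- Distinct elements overlap in a null set only. -/
theorem aedisjoint_body {M : Mesh d} {T T' : Finset (E d)} (hT : T ∈ M.elements)
    (hT' : T' ∈ M.elements) (hne : T ≠ T') : volume (body T ∩ body T') = 0 := by
  obtain ⟨x, hx, hx'⟩ : ∃ x ∈ T, x ∉ T' := by
    by_contra! h
    exact hne (Finset.eq_of_subset_of_card_le h (by rw [hT.2, hT'.2]))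
  have h0 : (baryCoord M T x : E d → ℝ) ≠ 0 := by
    intro h
    have h1 := ((baryCoord_spec hT).2.1 x hx x).1 rfl
    rw [h] at h1
    simp at h1
  -- The coordinate of a vertex `x` of `T` outside `T'` vanishes on the intersection, which
  -- therefore lies in the zero set of a nonzero affine function.
  refine measure_mono_null (fun y hy => ?_)
    (volume_zeroSet_eq_zero (affine_mem_polySpace (baryCoord M T x)) h0)
  have h1 := baryCoord_eq hT hT' hy.1 hy.2 x
  rw [(baryCoord_spec hT').1 x hx'] at h1
  exact h1

/-! ### Quasiuniform meshes -/

section Quasiuniform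

variable {M : Mesh d} {h ρ : ℝ}

theorem Mesh.IsQuasiuniform.dist_le (hM : M.IsQuasiuniform h ρ) {T : Finset (E d)}
    (hT : T ∈ M.elements) {x y : E d} (hx : x ∈ body T) (hy : y ∈ body T) : dist x y ≤ h :=
  (Metric.dist_le_diam_of_mem (isCompact_body T).isBounded hx hy).trans (hM T hT).1

theorem volume_real_closedBall (x : E d) {r : ℝ} (hr : 0 ≤ r) :
    volume.real (Metric.closedBall x r) = r ^ d * volume.real (Metric.ball (0 : E d) 1) := by
  have := Measure.addHaar_real_closedBall (volume : Measure (E d)) x hr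
  simpa using this

theorem unitBall_volume_pos : 0 < volume.real (Metric.ball (0 : E d) 1) :=
  ENNReal.toReal_pos (Metric.measure_ball_pos _ _ one_pos).ne' measure_ball_lt_top.ne

theorem Mesh.IsQuasiuniform.le_volume (hM : M.IsQuasiuniform h ρ) (hρ : 0 < ρ) (hh : 0 < h)
    {T : Finset (E d)} (hT : T ∈ M.elements) :
    ρ ^ d * volume.real (Metric.ball (0 : E d) 1) * h ^ d ≤ volume.real (body T) := by
  obtain ⟨x, hx⟩ := (hM T hT).2
  have h1 := measureReal_mono (μ := volume) hx (isCompact_body T).measure_lt_top.ne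
  rw [volume_real_closedBall x (by positivity), mul_pow] at h1
  linarith

theorem Mesh.IsQuasiuniform.subset_closedBall (hM : M.IsQuasiuniform h ρ) {T : Finset (E d)}
    (hT : T ∈ M.elements) {z x : E d} {r : ℝ} (hx : x ∈ body T) (hz : dist x z ≤ r * h) :
    body T ⊆ Metric.closedBall z ((r + 1) * h) := by
  intro y hy
  have h1 := dist_triangle y x z
  have h2 := hM.dist_le hT hy hx
  rw [Metric.mem_closedBall]
  linarith

theorem Mesh.IsQuasiuniform.volume_le (hM : M.IsQuasiuniform h ρ) (hh : 0 < h)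
    {T : Finset (E d)} (hT : T ∈ M.elements) :
    volume.real (body T) ≤ volume.real (Metric.ball (0 : E d) 1) * h ^ d := by
  obtain ⟨x, hx⟩ : T.Nonempty := Finset.card_pos.1 (by rw [hT.2]; omega)
  have h1 : body T ⊆ Metric.closedBall x h := fun y hy => hM.dist_le hT hy (mem_body hx)
  have h2 := measureReal_mono (μ := volume) h1 measure_closedBall_lt_top.ne
  rwa [volume_real_closedBall x hh.le, mul_comm] at h2

/-- The number of elements in a ball of radius `R * h` is bounded. -/
theorem Mesh.IsQuasiuniform.card_le (hM : M.IsQuasiuniform h ρ) (hρ : 0 < ρ) (hh : 0 < h)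
    {R : ℝ} (hR : 0 ≤ R) (z : E d) (𝒮 : Finset (Finset (E d)))
    (hS : ∀ T ∈ 𝒮, T ∈ M.elements ∧ body T ⊆ Metric.closedBall z (R * h)) :
    (𝒮.card : ℝ) ≤ (R / ρ) ^ d := by
  set ω := volume.real (Metric.ball (0 : E d) 1)
  have hω : 0 < ω := unitBall_volume_pos
  -- Volume comparison: the elements overlap in null sets, lie in one ball, and each has volume at
  -- least that of a ball of radius `ρ * h`.
  have h1 : ∑ T ∈ 𝒮, volume.real (body T) ≤ volume.real (Metric.closedBall z (R * h)) := by
    rw [← measureReal_biUnion_finset₀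
      (fun T hT T' hT' hne => aedisjoint_body (hS T hT).1 (hS T' hT').1 hne)
      (fun T _ => (measurableSet_body T).nullMeasurableSet)
      (fun T _ => (isCompact_body T).measure_lt_top.ne)]
    exact measureReal_mono (Set.iUnion₂_subset fun T hT => (hS T hT).2)
      measure_closedBall_lt_top.ne
  have h2 : (𝒮.card : ℝ) * (ρ ^ d * ω * h ^ d) ≤ ∑ T ∈ 𝒮, volume.real (body T) := by
    rw [← nsmul_eq_mul]
    exact Finset.card_nsmul_le_sum _ _ _ fun T hT => hM.le_volume hρ hh (hS T hT).1
  rw [volume_real_closedBall z (by positivity)] at h1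
  rw [div_pow, le_div_iff₀ (by positivity)]
  have h3 : (𝒮.card : ℝ) * ρ ^ d * (ω * h ^ d) ≤ R ^ d * (ω * h ^ d) := by
    rw [mul_pow] at h1
    linarith
  exact le_of_mul_le_mul_right h3 (by positivity)

theorem FaceNeighbors.exists_common (hd : 1 ≤ d) {T T' : Finset (E d)} (hTT : FaceNeighbors T T') :
    ∃ x, x ∈ T ∧ x ∈ T' := by
  have h1 : ((T : Set (E d)) ∩ (T' : Set (E d))).Nonempty := by
    refine Set.nonempty_of_ncard_ne_zero ?_
    rw [hTT]
    omega
  obtain ⟨x, hx⟩ := h1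
  exact ⟨x, hx.1, hx.2⟩

/-- Along a chain of face neighbors, the oscillations of a function add up at most. -/
theorem dist_le_of_chain (hd : 1 ≤ d) {X : Type*} [PseudoMetricSpace X] {f : E d → X} {β : ℝ}
    {P : ℕ → Finset (E d)} {n : ℕ}
    (hP : ∀ j, 1 ≤ j → j ≤ n → ∀ x ∈ body (P j), ∀ y ∈ body (P j), dist (f x) (f y) ≤ β)
    (hF : ∀ j, 1 ≤ j → j < n → FaceNeighbors (P j) (P (j + 1))) :
    ∀ j, 1 ≤ j → j ≤ n → ∀ x ∈ body (P 1), ∀ y ∈ body (P j), dist (f x) (f y) ≤ j * β := by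
  intro j hj
  induction j, hj using Nat.le_induction with
  | base =>
    intro hn x hx y hy
    simpa using hP 1 le_rfl hn x hx y hy
  | succ j hj ih =>
    intro hn x hx y hy
    obtain ⟨z, hz, hz'⟩ := (hF j hj hn).exists_common hd
    have h1 := ih (by omega) x hx z (mem_body hz)
    have h2 := hP (j + 1) (by omega) hn z (mem_body hz') y hy
    have h3 := dist_triangle (f x) (f z) (f y)
    push_cast
    linarith

/-- Used with `f = id` to bound distances along a path, and with `f = v` to bound the oscillation of
a finite element function. -/
theorem HasPath.dist_le (hd : 1 ≤ d) {X : Type*} [PseudoMetricSpace X] {f : E d → X} {β : ℝ}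
    (hβ : 0 ≤ β) {𝒯 : Set (Finset (E d))} {N : ℕ} {T T' : Finset (E d)}
    (hf : ∀ P ∈ 𝒯, ∀ x ∈ body P, ∀ y ∈ body P, dist (f x) (f y) ≤ β)
    (hp : HasPath 𝒯 N T T') : ∀ x ∈ body T, ∀ y ∈ body T', dist (f x) (f y) ≤ N * β := by
  obtain ⟨n, P, hn, hnN, rfl, rfl, hP, hF⟩ := hp
  intro x hx y hy
  refine (dist_le_of_chain hd (fun j h1 h2 => hf _ (hP j h1 h2)) hF n hn le_rfl x hx y hy).trans ?_
  gcongr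

/-- The elements of a path stay close to its first element. -/
theorem HasPath.near (hd : 1 ≤ d) (hM : M.IsQuasiuniform h ρ) (hh : 0 < h)
    {𝒯 : Set (Finset (E d))} (h𝒯 : 𝒯 ⊆ M.elements) {N : ℕ} {T T' : Finset (E d)}
    (hp : HasPath 𝒯 N T T') :
    HasPath {P | P ∈ 𝒯 ∧ ∀ x ∈ body T, ∀ y ∈ body P, dist x y ≤ N * h} N T T' := by
  obtain ⟨n, P, hn, hnN, rfl, rfl, hP, hF⟩ := hp
  refine ⟨n, P, hn, hnN, rfl, rfl, fun j h1 h2 => ⟨hP j h1 h2, fun x hx y hy => ?_⟩, hF⟩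
  refine (dist_le_of_chain hd (f := id)
    (fun j h1 h2 x hx y hy => hM.dist_le (h𝒯 (hP j h1 h2)) hx hy) hF j h1 h2 x hx y hy).trans ?_
  have : (j : ℝ) ≤ N := by exact_mod_cast h2.trans hnN
  gcongr

end Quasiuniform

end

/-! ### The reference simplex, element bases and degrees of freedom. -/

section

variable {d k : ℕ} {A : Type}

theorem refSimplex_subset : refSimplex d ⊆ Metric.closedBall (0 : E d) (Real.sqrt d) := by
  intro x hx
  rw [mem_closedBall_zero_iff, EuclideanSpace.norm_eq]
  refine Real.sqrt_le_sqrt ?_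
  calc ∑ i, ‖x i‖ ^ 2 ≤ ∑ _i : Fin d, (1 : ℝ) := by
        refine Finset.sum_le_sum fun i _ => ?_
        have h1 := Finset.single_le_sum (fun j _ => hx.1 j) (Finset.mem_univ i)
        have h2 : x i ≤ 1 := h1.trans hx.2
        rw [Real.norm_eq_abs, sq_abs]
        nlinarith [hx.1 i]
    _ = d := by simp

theorem isClosed_refSimplex : IsClosed (refSimplex d) := by
  have : refSimplex d = (⋂ i, {x : E d | 0 ≤ x i}) ∩ {x | ∑ i, x i ≤ 1} := by
    ext x
    simp [refSimplex]
  rw [this]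
  exact (isClosed_iInter fun i => isClosed_le continuous_const (by fun_prop)).inter
    (isClosed_le (by fun_prop) continuous_const)

theorem refSimplex_volume_pos : 0 < volume.real (refSimplex d) := by
  let U : Set (E d) := (⋂ i, {x : E d | 0 < x i}) ∩ {x | ∑ i, x i < 1}
  have hU : IsOpen U :=
    (isOpen_iInter_of_finite fun i => isOpen_lt continuous_const (by fun_prop)).inter
      (isOpen_lt (by fun_prop) continuous_const)
  have hne : U.Nonempty := by
    refine ⟨WithLp.toLp 2 fun _ => 1 / ((d : ℝ) + 1), Set.mem_iInter.2 fun i => ?_, ?_⟩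
    · change 0 < 1 / ((d : ℝ) + 1)
      positivity
    · change ∑ _i : Fin d, 1 / ((d : ℝ) + 1) < 1
      rw [Finset.sum_const, Finset.card_univ, Fintype.card_fin, nsmul_eq_mul, mul_one_div,
        div_lt_one (by positivity)]
      linarith
  have hsub : U ⊆ refSimplex d := fun x hx =>
    ⟨fun i => (Set.mem_iInter.1 hx.1 i).le, hx.2.le⟩
  have hfin : volume (refSimplex d) ≠ ⊤ :=
    ((measure_mono refSimplex_subset).trans_lt measure_closedBall_lt_top).ne
  exact ENNReal.toReal_pos ((hU.measure_pos volume hne).trans_le (measure_mono hsub)).ne' hfin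

theorem eq_of_eqOn_pos {p q : E d → ℝ} (hp : p ∈ polySpace d k) (hq : q ∈ polySpace d k)
    {s : Set (E d)} (hs : 0 < volume s) (h : Set.EqOn p q s) : p = q := by
  by_contra hne
  have h1 := volume_zeroSet_eq_zero (sub_mem hp hq) (sub_ne_zero.2 hne)
  exact hs.ne' (measure_mono_null (fun x hx => sub_eq_zero.2 (h hx)) h1)

theorem refSimplex_volume_pos' : 0 < volume (refSimplex d) :=
  (ENNReal.toReal_pos_iff.1 refSimplex_volume_pos).1

section Local

variable {φhat : Module.Basis A ℝ (polySpace d k)} {M : Mesh d} {Ω : Set (E d)} {I : Type}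
  {φ : I → E d → ℝ}

/-- Injectivity of `ι` is automatic: equal indices give reference functions that agree on a set of
positive volume, hence equal basis vectors. -/
theorem IsAffineEquivalent.exists_param (hφ : IsAffineEquivalent M Ω φhat φ) {T : Finset (E d)}
    (hT : T ∈ active M Ω) :
    ∃ (F : E d ≃ᵃ[ℝ] E d) (ι : A → I), F '' refSimplex d = body T ∧ Function.Injective ι ∧
      Set.range ι = localIdx φ T ∧
      ∀ a, ∀ x ∈ refSimplex d, φ (ι a) (F x) = (φhat a : E d → ℝ) x := by
  obtain ⟨F, ι, hF, hι, h⟩ := hφ T hT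
  refine ⟨F, ι, hF, fun a b hab => φhat.injective (Subtype.ext ?_), hι, h⟩
  refine eq_of_eqOn_pos (φhat a).2 (φhat b).2 refSimplex_volume_pos' fun x hx => ?_
  rw [← h a x hx, ← h b x hx, hab]

open Classical in
theorem sum_localIdx_eq [Fintype A] [Fintype I] {T : Finset (E d)} {ι : A → I} (hι : Function.Injective ι)
    (hr : Set.range ι = localIdx φ T) (f : I → ℝ) :
    ∑ j with j ∈ localIdx φ T, f j = ∑ a, f (ι a) := by
  have h1 : (Finset.univ.filter fun j => j ∈ localIdx φ T) = Finset.univ.image ι := by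
    ext j
    rw [← hr]
    simp
  rw [h1, Finset.sum_image fun a _ b _ hab => hι hab]

end Local

open Classical in
/-- The coefficients in the element basis are equivalent to the maximum norm on the element. -/
theorem exists_local_bounds [Fintype A] (φhat : Module.Basis A ℝ (polySpace d k)) :
    ∃ C : ℝ, 0 < C ∧ ∀ (M : Mesh d) (Ω : Set (E d)) (I : Type) [Fintype I] (φ : I → E d → ℝ),
      IsAffineEquivalent M Ω φhat φ → ∀ T ∈ active M Ω, ∀ (c : I → ℝ) (g : E d → ℝ) (B : ℝ),
        0 ≤ B → (∀ y ∈ body T, g y = ∑ j with j ∈ localIdx φ T, c j * φ j y) →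
        ((∀ y ∈ body T, |g y| ≤ B) → ∀ i ∈ localIdx φ T, |c i| ≤ C * B) ∧
        ((∀ i ∈ localIdx φ T, |c i| ≤ B) → ∀ y ∈ body T, |g y| ≤ C * B) := by
  obtain ⟨C, hC, hcoef⟩ := exists_coeff_sq_le φhat (Real.sqrt d) (refSimplex_volume_pos (d := d))
  obtain ⟨K, hK, hKb⟩ := exists_bound_shape φhat (Real.sqrt d)
  set V := volume.real (refSimplex d)
  have hV : 0 < V := refSimplex_volume_pos
  set C1 := Real.sqrt (C * V)
  refine ⟨C1 + Fintype.card A * K, by positivity, ?_⟩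
  intro M Ω I _ φ hφ T hT c g B hB hg
  -- Composition with `F` preserves both the coefficients and the maximum norm, so the constant does
  -- not depend on the shape of `T`.
  obtain ⟨F, ι, hF, hι, hr, hFι⟩ := hφ.exists_param hT
  have hgF : ∀ x ∈ refSimplex d, g (F x) = (φhat.equivFun.symm (c ∘ ι) : E d → ℝ) x := by
    intro x hx
    rw [hg (F x) (hF ▸ Set.mem_image_of_mem F hx), sum_localIdx_eq hι hr, equivFun_symm_coe,
      Finset.sum_apply]
    exact Finset.sum_congr rfl fun a _ => by simp [hFι a x hx]
  constructor
  · intro hb i hi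
    have h1 := hcoef _ refSimplex_subset isClosed_refSimplex.measurableSet le_rfl (c ∘ ι)
    have hfin : volume (refSimplex d) ≠ ⊤ :=
      ((measure_mono refSimplex_subset).trans_lt measure_closedBall_lt_top).ne
    have h2 : ∫ x in refSimplex d, (φhat.equivFun.symm (c ∘ ι) : E d → ℝ) x ^ 2 ≤ V * B ^ 2 := by
      calc ∫ x in refSimplex d, (φhat.equivFun.symm (c ∘ ι) : E d → ℝ) x ^ 2
          ≤ ∫ x in refSimplex d, B ^ 2 := by
            refine setIntegral_mono_on (integrableOn_of_continuous_of_subset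
              ((continuous_of_mem_polySpace (Submodule.coe_mem _)).pow 2) refSimplex_subset)
              (integrableOn_const hfin) isClosed_refSimplex.measurableSet fun x hx => ?_
            rw [← hgF x hx, ← sq_abs]
            exact pow_le_pow_left₀ (abs_nonneg _) (hb _ (hF ▸ Set.mem_image_of_mem F hx)) 2
        _ = V * B ^ 2 := by simp [V]
    have h3 : ‖c ∘ ι‖ ^ 2 ≤ (C1 * B) ^ 2 := by
      rw [mul_pow, Real.sq_sqrt (by positivity)]
      calc ‖c ∘ ι‖ ^ 2 ≤ C * (V * B ^ 2) := h1.trans (by gcongr)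
        _ = _ := by ring
    have h4 : ‖c ∘ ι‖ ≤ C1 * B := 
      (le_abs_self _).trans (abs_le_of_sq_le_sq h3 (by positivity))
    obtain ⟨a, rfl⟩ := hr ▸ hi
    have h5 : |c (ι a)| ≤ ‖c ∘ ι‖ := norm_le_pi_norm (c ∘ ι) a
    have h6 : 0 ≤ Fintype.card A * K * B := by positivity
    linarith
  · intro hb y hy
    rw [← hF] at hy
    obtain ⟨x, hx, rfl⟩ := hy
    rw [hgF x hx]
    have h1 := abs_combination_le φhat (fun a => (hKb a x (refSimplex_subset hx)).1) (c ∘ ι)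
    have h2 : ‖c ∘ ι‖ ≤ B := by
      rw [pi_norm_le_iff_of_nonneg hB]
      exact fun a => hb _ (hr ▸ Set.mem_range_self a)
    have h3 : Fintype.card A * K * ‖c ∘ ι‖ ≤ Fintype.card A * K * B := by gcongr
    have h4 : 0 ≤ C1 * B := by positivity
    linarith

section Dof

variable {φhat : Module.Basis A ℝ (polySpace d k)} {M : Mesh d} {Ω : Set (E d)} {I : Type}
  [Fintype A] [Fintype I] {φ : I → E d → ℝ}

open Classical in
/-- Local expansions are unique. -/
theorem IsAffineEquivalent.coeff_unique (hφ : IsAffineEquivalent M Ω φhat φ) {T : Finset (E d)}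
    (hT : T ∈ active M Ω) {c c' : I → ℝ}
    (h : ∀ y ∈ body T, ∑ j with j ∈ localIdx φ T, c j * φ j y =
      ∑ j with j ∈ localIdx φ T, c' j * φ j y) {i : I} (hi : i ∈ localIdx φ T) : c i = c' i := by
  obtain ⟨C, -, hb⟩ := exists_local_bounds φhat
  -- The difference of the expansions vanishes on `T`; the coefficient bound with `B = 0` then
  -- forces the coefficients to agree.
  have h1 := (hb M Ω I φ hφ T hT (c - c') 0 0 le_rfl (fun y hy => ?_)).1 (by simp) i hi
  · rw [mul_zero] at h1
    exact sub_eq_zero.1 (abs_nonpos_iff.1 h1)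
  · have := h y hy
    simp only [Pi.sub_apply, sub_mul, Finset.sum_sub_distrib, Pi.zero_apply]
    linarith

open Classical in
theorem IsAffineEquivalent.exists_expansion (hφ : IsAffineEquivalent M Ω φhat φ)
    {T : Finset (E d)} (hT : T ∈ active M Ω) {p : E d → ℝ} (hp : p ∈ polySpace d k) :
    ∃ c : I → ℝ, ∀ y ∈ body T, p y = ∑ j with j ∈ localIdx φ T, c j * φ j y := by
  obtain ⟨F, ι, hF, hι, hr, hFι⟩ := hφ.exists_param hT
  obtain ⟨c, hc⟩ := φhat.equivFun.symm.surjective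
    ⟨_, comp_affine_mem_polySpace hp (F : E d →ᵃ[ℝ] E d)⟩
  -- Coefficients outside `I_T` do not enter the sum; they are set to zero.
  refine ⟨Function.extend ι c 0, fun y hy => ?_⟩
  rw [← hF] at hy
  obtain ⟨x, hx, rfl⟩ := hy
  have h1 : p (F x) = (φhat.equivFun.symm c : E d → ℝ) x := by
    rw [hc]
    rfl
  rw [h1, sum_localIdx_eq hι hr, equivFun_symm_coe, Finset.sum_apply]
  exact Finset.sum_congr rfl fun a _ => by simp [hFι a x hx, hι.extend_apply]

-- The choice in `dof` does not depend on `i`, so the values for all `i` come from one and the same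
-- expansion.
open Classical in
theorem IsAffineEquivalent.dof_spec (hφ : IsAffineEquivalent M Ω φhat φ)
    {T : Finset (E d)} (hT : T ∈ active M Ω) {p : E d → ℝ} (hp : p ∈ polySpace d k) :
    ∃ c : I → ℝ, (∀ y ∈ body T, p y = ∑ j with j ∈ localIdx φ T, c j * φ j y) ∧
      ∀ i, dof φ i T p = c i := by
  have h := hφ.exists_expansion hT hp
  exact ⟨h.choose, h.choose_spec, fun i => by rw [dof, dif_pos h]⟩

end Dof

end

/-! ### The global finite element space and locality of its basis. -/

section

variable {d k : ℕ} {A : Type} {φhat : Module.Basis A ℝ (polySpace d k)} {M : Mesh d}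
  {Ω : Set (E d)} {h ρ γ : ℝ}

theorem body_subset_activeDomain {T : Finset (E d)} (hT : T ∈ active M Ω) :
    body T ⊆ activeDomain M Ω :=
  Set.subset_biUnion_of_mem (u := fun T : Finset (E d) => body T) hT

theorem restrictTo_eqOn {T : Finset (E d)} (hT : T ∈ active M Ω) (u : E d → ℝ) :
    Set.EqOn (restrictTo (activeDomain M Ω) u) u (body T) := fun _ hy =>
  Set.indicator_of_mem (body_subset_activeDomain hT hy) u

theorem exists_polynomial_of_mem_feSpace {v : E d → ℝ} (hv : v ∈ feSpace M Ω k)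
    {T : Finset (E d)} (hT : T ∈ active M Ω) : ∃ p ∈ polySpace d k, Set.EqOn v p (body T) := by
  obtain ⟨u, hu, rfl⟩ := hv
  obtain ⟨p, hp, hup⟩ := hu.2 T hT.1
  exact ⟨p, hp, fun y hy => (restrictTo_eqOn hT u hy).trans (hup hy)⟩

theorem polyExt_spec {v : E d → ℝ} (hv : v ∈ feSpace M Ω k)
    {T : Finset (E d)} (hT : T ∈ active M Ω) :
    polyExt k v T ∈ polySpace d k ∧ Set.EqOn v (polyExt k v T) (body T) := by
  have h := exists_polynomial_of_mem_feSpace hv hT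
  rw [polyExt, dif_pos h]
  exact h.choose_spec

theorem Mesh.IsQuasiuniform.interior_nonempty (hM : M.IsQuasiuniform h ρ) (hρ : 0 < ρ)
    (hh : 0 < h) {T : Finset (E d)} (hT : T ∈ M.elements) : (interior (body T)).Nonempty := by
  obtain ⟨x, hx⟩ := (hM T hT).2
  exact ⟨x, mem_interior.2 ⟨_, Metric.ball_subset_closedBall.trans hx, Metric.isOpen_ball,
    Metric.mem_ball_self (by positivity)⟩⟩

theorem Mesh.IsQuasiuniform.volume_pos (hM : M.IsQuasiuniform h ρ) (hρ : 0 < ρ)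
    (hh : 0 < h) {T : Finset (E d)} (hT : T ∈ M.elements) : 0 < volume (body T) :=
  (isOpen_interior.measure_pos volume (hM.interior_nonempty hρ hh hT)).trans_le
    (measure_mono interior_subset)

/-- Elements have positive volume, so the polynomial chosen in `polyExt` is unique. -/
theorem polyExt_eq (hM : M.IsQuasiuniform h ρ) (hρ : 0 < ρ) (hh : 0 < h) {v : E d → ℝ}
    (hv : v ∈ feSpace M Ω k) {T : Finset (E d)} (hT : T ∈ active M Ω) {p : E d → ℝ}
    (hp : p ∈ polySpace d k) (hvp : Set.EqOn v p (body T)) : polyExt k v T = p :=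
  eq_of_eqOn_pos (polyExt_spec hv hT).1 hp (hM.volume_pos hρ hh hT.1)
    fun _ hy => ((polyExt_spec hv hT).2 hy).symm.trans (hvp hy)

theorem jump_mem_polySpace {v : E d → ℝ} (hv : v ∈ feSpace M Ω k) {T₁ T₂ : Finset (E d)}
    (hT₁ : T₁ ∈ active M Ω) (hT₂ : T₂ ∈ active M Ω) : jump k v T₁ T₂ ∈ polySpace d k :=
  sub_mem (polyExt_spec hv hT₁).1 (polyExt_spec hv hT₂).1

/-- The constant function one on the active domain. -/
theorem one_mem_feSpace : restrictTo (activeDomain M Ω) (fun _ => 1) ∈ feSpace M Ω k :=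
  Submodule.mem_map_of_mem (one_mem_bgSpace M)

theorem polyExt_sub_const (hM : M.IsQuasiuniform h ρ) (hρ : 0 < ρ) (hh : 0 < h) {v : E d → ℝ}
    (hv : v ∈ feSpace M Ω k) (c : ℝ) {T : Finset (E d)} (hT : T ∈ active M Ω) :
    polyExt k (v - c • restrictTo (activeDomain M Ω) fun _ => 1) T =
      polyExt k v T - fun _ => c := by
  refine polyExt_eq hM hρ hh (sub_mem hv (Submodule.smul_mem _ _ one_mem_feSpace)) hT
    (sub_mem (polyExt_spec hv hT).1 (const_mem_polySpace c)) fun y hy => ?_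
  have h1 := (polyExt_spec hv hT).2 hy
  have h2 := restrictTo_eqOn hT (fun _ => (1 : ℝ)) hy
  simp [h1, h2]

/-- An active element on which a finite element function does not vanish identically is contained
in its support. -/
theorem eq_zero_of_not_subset_tsupport (hM : M.IsQuasiuniform h ρ) (hρ : 0 < ρ) (hh : 0 < h)
    {v : E d → ℝ} (hv : v ∈ feSpace M Ω k) {T : Finset (E d)} (hT : T ∈ active M Ω)
    (hs : ¬ body T ⊆ tsupport v) : ∀ y ∈ body T, v y = 0 := by
  obtain ⟨p, hp, hvp⟩ := exists_polynomial_of_mem_feSpace hv hT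
  by_cases h0 : p = 0
  · intro y hy
    rw [hvp hy, h0]
    rfl
  · refine absurd (fun x hx => ?_) hs
    -- A convex body with interior points is the closure of its interior, and a nonzero polynomial
    -- cannot vanish on a nonempty open set.
    have hcl : closure (interior (body T)) = closure (body T) :=
      (convex_convexHull ℝ _).closure_interior_eq_closure_of_nonempty_interior
        (hM.interior_nonempty hρ hh hT.1)
    have hx' : x ∈ closure (interior (body T)) := hcl ▸ subset_closure hx
    rw [tsupport, mem_closure_iff]
    intro U hU hxU
    have hne : (U ∩ interior (body T)).Nonempty := mem_closure_iff.1 hx' U hU hxU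
    have hpos := (hU.inter isOpen_interior).measure_pos volume hne
    by_contra hemp
    refine hpos.ne' (measure_mono_null (fun y hy => ?_) (volume_zeroSet_eq_zero hp h0))
    by_contra hy0
    refine hemp ⟨y, hy.1, ?_⟩
    rw [Function.mem_support, hvp (interior_subset hy.2)]
    exact hy0

section Basis

variable {I : Type} [Fintype I] (φ : Module.Basis I ℝ (feSpace M Ω k))

-- Basis functions whose support does not contain `T` vanish on `T`, so the global expansion
-- restricts to `I_T`.
open Classical in
theorem eqOn_local_expansion (hM : M.IsQuasiuniform h ρ) (hρ : 0 < ρ) (hh : 0 < h)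
    (v : feSpace M Ω k) {T : Finset (E d)} (hT : T ∈ active M Ω) :
    ∀ y ∈ body T, (v : E d → ℝ) y =
      ∑ j with j ∈ localIdx (fun i => (φ i : E d → ℝ)) T, φ.repr v j * (φ j : E d → ℝ) y := by
  intro y hy
  have h1 : (v : E d → ℝ) y = ∑ j, φ.repr v j * (φ j : E d → ℝ) y := by
    conv_lhs => rw [← φ.sum_repr v]
    rw [Submodule.coe_sum, Finset.sum_apply]
    rfl
  rw [h1, Finset.sum_filter]
  refine Finset.sum_congr rfl fun j _ => ?_
  split_ifs with hj
  · rfl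
  · rw [eq_zero_of_not_subset_tsupport hM hρ hh (φ j).2 hT hj y hy, mul_zero]

variable [Fintype A]

/-- Coefficients are determined by the restriction to an element. -/
theorem repr_eq_of_eqOn (hM : M.IsQuasiuniform h ρ) (hρ : 0 < ρ) (hh : 0 < h)
    (hφ : IsAffineEquivalent M Ω φhat fun i => (φ i : E d → ℝ)) {T : Finset (E d)}
    (hT : T ∈ active M Ω) {v w : feSpace M Ω k} (hvw : Set.EqOn (v : E d → ℝ) w (body T)) {i : I}
    (hi : i ∈ localIdx (fun i => (φ i : E d → ℝ)) T) : φ.repr v i = φ.repr w i := by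
  refine hφ.coeff_unique hT (fun y hy => ?_) hi
  rw [← eqOn_local_expansion φ hM hρ hh v hT y hy, ← eqOn_local_expansion φ hM hρ hh w hT y hy]
  exact hvw hy

/-- The elements in the support of a basis function share a vertex. -/
theorem exists_common_vertex (hk : 1 ≤ k) (hM : M.IsQuasiuniform h ρ) (hρ : 0 < ρ) (hh : 0 < h)
    (hφ : IsAffineEquivalent M Ω φhat fun i => (φ i : E d → ℝ)) (i : I) :
    ∃ x, ∀ T ∈ active M Ω, i ∈ localIdx (fun i => (φ i : E d → ℝ)) T → x ∈ T := by
  by_cases hne : ∃ T ∈ active M Ω, i ∈ localIdx (fun i => (φ i : E d → ℝ)) T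
  swap
  · exact ⟨0, fun T hT hi => absurd ⟨T, hT, hi⟩ hne⟩
  obtain ⟨T₀, hT₀, hi₀⟩ := hne
  let ψ : (x : E d) → (q : E d → ℝ) → q ∈ polySpace d (k - 1) → feSpace M Ω k := fun x q hq =>
    ⟨restrictTo (activeDomain M Ω) (hatFun M x * q),
      Submodule.mem_map_of_mem (hatFun_mul_mem_bgSpace hk M x hq)⟩
  have hψ : ∀ {T : Finset (E d)}, T ∈ active M Ω → ∀ x q hq, ∀ y ∈ body T,
      (ψ x q hq : E d → ℝ) y = baryCoord M T x y * q y := by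
    intro T hT x q hq y hy
    rw [← hatFun_eq hT.1 hy x]
    exact restrictTo_eqOn hT _ hy
  -- The products of hat functions at the vertices of `T₀` with polynomials of degree `k - 1` span
  -- `ℙ_k` on `T₀`. If all had zero `i`-th coefficient, so would `φ i` itself, because the
  -- coefficient depends only on the restriction to `T₀`.
  obtain ⟨x, hx, q, hq, hc⟩ : ∃ x ∈ T₀, ∃ q, ∃ hq : q ∈ polySpace d (k - 1),
      φ.repr (ψ x q hq) i ≠ 0 := by
    by_contra! hcon
    let W : Submodule ℝ (E d → ℝ) :=
      { carrier := {p | ∃ w : feSpace M Ω k, φ.repr w i = 0 ∧ Set.EqOn (w : E d → ℝ) p (body T₀)}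
        zero_mem' := ⟨0, by simp, fun _ _ => rfl⟩
        add_mem' := by
          rintro p p' ⟨w, hw, hp⟩ ⟨w', hw', hp'⟩
          exact ⟨w + w', by simp [hw, hw'], fun y hy => by simp [hp hy, hp' hy]⟩
        smul_mem' := by
          rintro c p ⟨w, hw, hp⟩
          exact ⟨c • w, by simp [hw], fun y hy => by simp [hp hy]⟩ }
    obtain ⟨p, hp, hφp⟩ := exists_polynomial_of_mem_feSpace (φ i).2 hT₀
    have hW : polySpace d k ≤ W := by
      refine (polySpace_le_span_mul hk).trans (Submodule.span_le.2 ?_)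
      rintro _ ⟨a, q, hq, rfl⟩
      have h1 : (a : E d → ℝ) * q = ∑ x ∈ T₀, a x • ((baryCoord M T₀ x : E d → ℝ) * q) := by
        ext y
        rw [Pi.mul_apply, (baryCoord_spec hT₀.1).2.2 a y, Finset.sum_mul, Finset.sum_apply]
        exact Finset.sum_congr rfl fun x _ => by simp [mul_assoc]
      rw [h1]
      exact Submodule.sum_mem _ fun x hx => Submodule.smul_mem _ _
        ⟨ψ x q hq, hcon x hx q hq, fun y hy => hψ hT₀ x q hq y hy⟩
    obtain ⟨w, hw, hwp⟩ := hW hp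
    have h2 := repr_eq_of_eqOn φ hM hρ hh hφ hT₀ (v := w) (w := φ i)
      (fun y hy => (hwp hy).trans (hφp hy).symm) hi₀
    rw [hw] at h2
    simp at h2
  refine ⟨x, fun T hT hi => ?_⟩
  by_contra hxT
  refine hc ?_
  -- If `x` were not a vertex of `T`, the function found above would vanish on `T`, and reading its
  -- coefficient off on `T` would give zero.
  have h3 := repr_eq_of_eqOn φ hM hρ hh hφ hT (v := ψ x q hq) (w := 0) (fun y hy => ?_) hi
  · simpa using h3
  · rw [hψ hT x q hq y hy, (baryCoord_spec hT.1).1 x hxT]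
    simp

end Basis

end

/-! ### From elementwise estimates to integrals over the mesh. -/

section

variable {d k : ℕ} {A : Type} {φhat : Module.Basis A ℝ (polySpace d k)} {M : Mesh d}
  {Ω : Set (E d)} {h ρ γ : ℝ}

/-! ### Integration over elements -/

theorem sum_integral_elements {𝒮 : Finset (Finset (E d))} (h𝒮 : ∀ T ∈ 𝒮, T ∈ M.elements)
    {X : Set (E d)} (hX : MeasurableSet X) {f : E d → ℝ}
    (hf : ∀ T ∈ 𝒮, IntegrableOn f (body T)) :
    ∫ x in ⋃ T ∈ 𝒮, body T ∩ X, f x = ∑ T ∈ 𝒮, ∫ x in body T ∩ X, f x := by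
  have h1 : (⋃ T ∈ 𝒮, body T ∩ X) = ⋃ T : 𝒮, body (T : Finset (E d)) ∩ X := by
    ext x
    simp only [Set.mem_iUnion, Subtype.exists, exists_prop]
  rw [h1, integral_iUnion_ae, tsum_fintype, ← Finset.sum_coe_sort 𝒮]
  · exact fun T => ((measurableSet_body _).inter hX).nullMeasurableSet
  · intro T T' hne
    refine measure_mono_null ?_ (aedisjoint_body (h𝒮 T T.2) (h𝒮 T' T'.2)
      (fun h => hne (Subtype.ext h)))
    exact Set.inter_subset_inter Set.inter_subset_left Set.inter_subset_left
  · rw [integrableOn_finite_iUnion]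
    exact fun T => (hf T T.2).mono_set Set.inter_subset_left

theorem finite_active : (active M Ω).Finite := M.finite_elements.subset fun _ hT => hT.1

theorem finite_largeElems : (largeElems M Ω γ).Finite :=
  finite_active.subset fun _ hT => hT.1

theorem subset_activeDomain (hsub : Ω ⊆ M.domain) : Ω ⊆ activeDomain M Ω := by
  intro x hx
  obtain ⟨T, hT, hxT⟩ := Mesh.mem_domain_iff.1 (hsub hx)
  exact body_subset_activeDomain ⟨hT, x, hxT, hx⟩ hxT

theorem activeDomain_eq : activeDomain M Ω =
    ⋃ T ∈ (finite_active (M := M) (Ω := Ω)).toFinset, body T ∩ Set.univ := by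
  ext x
  simp [activeDomain]

theorem integral_activeDomain {f : E d → ℝ} (hf : ∀ T ∈ active M Ω, IntegrableOn f (body T)) :
    ∫ x in activeDomain M Ω, f x =
      ∑ T ∈ (finite_active (M := M) (Ω := Ω)).toFinset, ∫ x in body T, f x := by
  rw [activeDomain_eq, sum_integral_elements (M := M) _ MeasurableSet.univ]
  · simp
  · exact fun T hT => hf T (by simpa using hT)
  · exact fun T hT => (show T ∈ active M Ω by simpa using hT).1

theorem sum_integral_large_le (hΩ : IsClosed Ω) (hsub : Ω ⊆ M.domain) {f : E d → ℝ}
    (hf0 : ∀ x, 0 ≤ f x) (hf : ∀ T ∈ active M Ω, IntegrableOn f (body T)) :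
    ∑ T ∈ (finite_largeElems (M := M) (Ω := Ω) (γ := γ)).toFinset, ∫ x in body T ∩ Ω, f x ≤
      ∫ x in Ω, f x := by
  have hL : ∀ T ∈ (finite_largeElems (M := M) (Ω := Ω) (γ := γ)).toFinset, T ∈ active M Ω := by
    intro T hT
    exact (show T ∈ largeElems M Ω γ by simpa using hT).1
  rw [← sum_integral_elements (fun T hT => (hL T hT).1) hΩ.measurableSet fun T hT => hf T (hL T hT)]
  have hint : IntegrableOn f Ω := by
    refine IntegrableOn.mono_set ?_ (subset_activeDomain hsub)
    exact (integrableOn_finite_biUnion finite_active).2 hf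
  refine setIntegral_mono_set hint (Filter.Eventually.of_forall hf0) (LE.le.eventuallyLE ?_)
  exact Set.iUnion₂_subset fun T _ => Set.inter_subset_right

/-- Equality on the closed element gives equal derivatives only at interior points; the boundary of
a convex set is null. -/
theorem gradient_ae_eq {v p : E d → ℝ} {T : Finset (E d)} (hvp : Set.EqOn v p (body T)) :
    ∀ᵐ x, x ∈ body T → gradient v x = gradient p x := by
  have h0 : volume (frontier (body T)) = 0 := (convex_convexHull ℝ _).addHaar_frontier volume
  filter_upwards [compl_mem_ae_iff.2 h0] with x hx hxT
  have hxi : x ∈ interior (body T) := by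
    by_contra hxi
    exact hx ⟨subset_closure hxT, hxi⟩
  have h1 : v =ᶠ[nhds x] p :=
    Filter.eventually_of_mem (mem_interior_iff_mem_nhds.1 hxi) fun y hy => hvp hy
  rw [gradient, gradient, h1.fderiv_eq]

theorem continuous_norm_gradient_sq {p : E d → ℝ} (hp : p ∈ polySpace d k) :
    Continuous fun x => ‖gradient p x‖ ^ 2 := by
  simp_rw [norm_gradient]
  exact ((contDiff_of_mem_polySpace hp (n := 1)).continuous_fderiv (by norm_num)).norm.pow 2

theorem integrableOn_body {f : E d → ℝ} (hf : Continuous f) (T : Finset (E d)) :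
    IntegrableOn f (body T) :=
  hf.continuousOn.integrableOn_compact (isCompact_body T)

theorem integrableOn_sq {v : E d → ℝ} (hv : v ∈ feSpace M Ω k) {T : Finset (E d)}
    (hT : T ∈ active M Ω) : IntegrableOn (fun x => v x ^ 2) (body T) := by
  obtain ⟨hp, hvp⟩ := polyExt_spec hv hT
  refine (integrableOn_body ((continuous_of_mem_polySpace hp).pow 2) T).congr_fun
    (fun x hx => ?_) (measurableSet_body T)
  simp [hvp hx]

theorem integrableOn_gradient_sq {v : E d → ℝ} (hv : v ∈ feSpace M Ω k) {T : Finset (E d)}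
    (hT : T ∈ active M Ω) : IntegrableOn (fun x => ‖gradient v x‖ ^ 2) (body T) := by
  obtain ⟨hp, hvp⟩ := polyExt_spec hv hT
  refine (integrableOn_body (continuous_norm_gradient_sq hp) T).congr_fun_ae ?_
  rw [Filter.EventuallyEq, ae_restrict_iff' (measurableSet_body T)]
  filter_upwards [gradient_ae_eq hvp] with x hx hxT
  rw [hx hxT]

theorem integral_gradient_sq_eq {v : E d → ℝ} (hv : v ∈ feSpace M Ω k) {T : Finset (E d)}
    (hT : T ∈ active M Ω) {X : Set (E d)} (hX : MeasurableSet X) :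
    ∫ x in body T ∩ X, ‖gradient v x‖ ^ 2 =
      ∫ x in body T ∩ X, ‖gradient (polyExt k v T) x‖ ^ 2 := by
  refine setIntegral_congr_ae ((measurableSet_body T).inter hX) ?_
  filter_upwards [gradient_ae_eq (polyExt_spec hv hT).2] with x hx hxT
  rw [hx hxT.1]

theorem integral_sq_eq {v : E d → ℝ} (hv : v ∈ feSpace M Ω k) {T : Finset (E d)}
    (hT : T ∈ active M Ω) {X : Set (E d)} (hX : MeasurableSet X) :
    ∫ x in body T ∩ X, v x ^ 2 = ∫ x in body T ∩ X, polyExt k v T x ^ 2 := by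
  refine setIntegral_congr_fun ((measurableSet_body T).inter hX) fun x hx => ?_
  simp only [(polyExt_spec hv hT).2 hx.1]

theorem setIntegral_body_le (hM : M.IsQuasiuniform h ρ) (hh : 0 < h) {T : Finset (E d)}
    (hT : T ∈ M.elements) {f : E d → ℝ} (hf : IntegrableOn f (body T)) {B : ℝ} (hB : 0 ≤ B)
    (hb : ∀ x ∈ body T, f x ≤ B) :
    ∫ x in body T, f x ≤ volume.real (Metric.ball (0 : E d) 1) * (h ^ d * B) := by
  calc ∫ x in body T, f x ≤ ∫ x in body T, B :=
        setIntegral_mono_on hf (integrableOn_const (isCompact_body T).measure_lt_top.ne)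
          (measurableSet_body T) hb
    _ = volume.real (body T) * B := by simp
    _ ≤ volume.real (Metric.ball (0 : E d) 1) * h ^ d * B :=
        mul_le_mul_of_nonneg_right (hM.volume_le hh hT) hB
    _ = _ := by ring

/-! ### Neighborhoods of elements -/

/-- The elements `T` and `P` have points at distance at most `r`. -/
def IsNear (r : ℝ) (T P : Finset (E d)) : Prop :=
  ∃ x ∈ body T, ∃ y ∈ body P, dist x y ≤ r

-- The radius `R + 2` adds the diameters of `P` and of `T` to the gap `R * h`.
open Classical in
theorem card_near_le (hM : M.IsQuasiuniform h ρ) (hρ : 0 < ρ) (hh : 0 < h) {R : ℝ} (hR : 0 ≤ R)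
    {P : Finset (E d)} (hP : P ∈ M.elements) {𝒮 : Finset (Finset (E d))}
    (h𝒮 : ∀ T ∈ 𝒮, T ∈ M.elements) :
    ((𝒮.filter fun T => IsNear (R * h) T P).card : ℝ) ≤ ((R + 2) / ρ) ^ d := by
  obtain ⟨z, hz⟩ : P.Nonempty := Finset.card_pos.1 (by rw [hP.2]; omega)
  refine hM.card_le hρ hh (by linarith) z _ fun T hT => ?_
  obtain ⟨hT1, x, hx, y, hy, hxy⟩ := Finset.mem_filter.1 hT
  refine ⟨h𝒮 T hT1, ?_⟩
  have h1 := hM.dist_le hP hy (mem_body hz)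
  have h2 := dist_triangle x y z
  have h3 := hM.subset_closedBall (h𝒮 T hT1) (z := z) (r := R + 1) hx (by linarith)
  rwa [add_assoc, one_add_one_eq_two] at h3

open Classical in
/-- Summation of local bounds by contributions of neighboring large elements and of indices. -/
theorem sum_local_le {I : Type} [Fintype I] {𝒜 ℒ : Finset (Finset (E d))}
    {near : Finset (E d) → Finset (E d) → Prop} {loc : Finset (E d) → Set I} {J : Set I}
    {C K : ℝ} (hC : 0 ≤ C)
    (hnear : ∀ P ∈ ℒ, ((𝒜.filter fun T => near T P).card : ℝ) ≤ K)
    (hloc : ∀ i, ((𝒜.filter fun T => i ∈ loc T).card : ℝ) ≤ K)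
    {X Y : Finset (E d) → ℝ} {Z : I → ℝ} (hY : ∀ P ∈ ℒ, 0 ≤ Y P) (hZ : ∀ i, 0 ≤ Z i)
    (hX : ∀ T ∈ 𝒜, X T ≤ C * (∑ P ∈ ℒ with near T P, Y P + ∑ i with i ∈ loc T ∧ i ∈ J, Z i)) :
    ∑ T ∈ 𝒜, X T ≤ C * K * (∑ P ∈ ℒ, Y P + ∑ i with i ∈ J, Z i) := by
  -- Exchanging the sums counts each `Y P`, and below each `Z i`, at most `K` times.
  have h1 : ∑ T ∈ 𝒜, ∑ P ∈ ℒ with near T P, Y P ≤ K * ∑ P ∈ ℒ, Y P := by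
    simp_rw [Finset.sum_filter]
    rw [Finset.sum_comm, Finset.mul_sum]
    refine Finset.sum_le_sum fun P hP => ?_
    rw [← Finset.sum_filter, Finset.sum_const, nsmul_eq_mul]
    exact mul_le_mul_of_nonneg_right (hnear P hP) (hY P hP)
  have h2 : ∑ T ∈ 𝒜, ∑ i with i ∈ loc T ∧ i ∈ J, Z i ≤ K * ∑ i with i ∈ J, Z i := by
    have h3 : ∀ T, ∑ i with i ∈ loc T ∧ i ∈ J, Z i =
        ∑ i with i ∈ J, if i ∈ loc T then Z i else 0 := by
      intro T
      rw [← Finset.sum_filter, Finset.filter_filter]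
      simp_rw [and_comm]
    simp_rw [h3]
    rw [Finset.sum_comm, Finset.mul_sum]
    refine Finset.sum_le_sum fun i _ => ?_
    rw [← Finset.sum_filter, Finset.sum_const, nsmul_eq_mul]
    exact mul_le_mul_of_nonneg_right (hloc i) (hZ i)
  calc ∑ T ∈ 𝒜, X T
      ≤ ∑ T ∈ 𝒜, C * (∑ P ∈ ℒ with near T P, Y P + ∑ i with i ∈ loc T ∧ i ∈ J, Z i) :=
        Finset.sum_le_sum hX
    _ = C * (∑ T ∈ 𝒜, ∑ P ∈ ℒ with near T P, Y P +
          ∑ T ∈ 𝒜, ∑ i with i ∈ loc T ∧ i ∈ J, Z i) := by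
        rw [← Finset.mul_sum, Finset.sum_add_distrib]
    _ ≤ C * (K * ∑ P ∈ ℒ, Y P + K * ∑ i with i ∈ J, Z i) := by gcongr
    _ = _ := by ring

end

/-! ### Coefficient bounds and the resulting pointwise bounds on one element. -/

section

variable {d k : ℕ} {A : Type}

/-- The functions of a basis of the finite element space. -/
noncomputable abbrev shape {M : Mesh d} {Ω : Set (E d)} {I : Type} (φ : Module.Basis I ℝ (feSpace M Ω k)) :
    I → E d → ℝ :=
  fun i => (φ i : E d → ℝ)

/-- The setting of the stabilization estimates: a quasiuniform mesh, an affine equivalent basis,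
a map from small to large elements, and a choice of elements satisfying the path assumption. -/
structure IsStabilized (φhat : Module.Basis A ℝ (polySpace d k)) (ρ γ : ℝ) (N : ℕ) (h : ℝ)
    (M : Mesh d) (Ω : Set (E d)) {I : Type} [Fintype I] (φ : Module.Basis I ℝ (feSpace M Ω k))
    (S : Finset (E d) → Finset (E d)) (Ts : I → Finset (E d)) : Prop where
  pos : 0 < h
  mesh : M.IsQuasiuniform h ρ
  isClosed : IsClosed Ω
  subset : Ω ⊆ M.domain
  affine : IsAffineEquivalent M Ω φhat (shape φ)
  large : ∀ T ∈ smallElems M Ω γ, S T ∈ largeElems M Ω γ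
  mem : ∀ i ∈ smallIdx M Ω γ (shape φ), Ts i ∈ active M Ω ∧ i ∈ localIdx (shape φ) (Ts i)
  path : PathAssumption M Ω γ (shape φ) S Ts N

section

variable {φhat : Module.Basis A ℝ (polySpace d k)} {ρ γ : ℝ} {N : ℕ} {h : ℝ}
    {M : Mesh d} {Ω : Set (E d)} {I : Type} [Fintype I] {φ : Module.Basis I ℝ (feSpace M Ω k)}
    {S : Finset (E d) → Finset (E d)} {Ts : I → Finset (E d)}

theorem IsStabilized.small (hs : IsStabilized φhat ρ γ N h M Ω φ S Ts) {i : I}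
    (hi : i ∈ smallIdx M Ω γ (shape φ)) : Ts i ∈ smallElems M Ω γ :=
  ⟨(hs.mem i hi).1, fun hL => hi _ hL (hs.mem i hi).2⟩

theorem IsStabilized.dist_le (hd : 1 ≤ d) (hs : IsStabilized φhat ρ γ N h M Ω φ S Ts) {i : I}
    (hi : i ∈ smallIdx M Ω γ (shape φ)) {x y : E d} (hx : x ∈ body (Ts i))
    (hy : y ∈ body (S (Ts i))) : dist x y ≤ N * h :=
  HasPath.dist_le hd (f := id) hs.pos.le (fun _ hP _ hx _ hy => hs.mesh.dist_le hP.1 hx hy)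
    (hs.path i hi) x hx y hy

/-- The sum of the squared degrees of freedom of the jumps that belong to an element. -/
noncomputable def jumpSum (γ : ℝ) (φ : Module.Basis I ℝ (feSpace M Ω k))
    (S : Finset (E d) → Finset (E d)) (Ts : I → Finset (E d)) (w : E d → ℝ)
    (T : Finset (E d)) : ℝ :=
  open Classical in
  ∑ i with i ∈ localIdx (shape φ) T ∧ i ∈ smallIdx M Ω γ (shape φ),
    dof (shape φ) i (Ts i) (jump k w (Ts i) (S (Ts i))) ^ 2

theorem jumpSum_nonneg (w : E d → ℝ) (T : Finset (E d)) : 0 ≤ jumpSum γ φ S Ts w T :=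
  Finset.sum_nonneg fun _ _ => sq_nonneg _

end

/-- A global coefficient is controlled by the values on a large element in the support, or by a
jump and the values on the large element assigned to it. -/
theorem exists_coeff_le [Fintype A] (hd : 1 ≤ d) (φhat : Module.Basis A ℝ (polySpace d k)) {ρ : ℝ}
    (hρ : 0 < ρ) (γ : ℝ) (N : ℕ) :
    ∃ C : ℝ, 0 < C ∧ ∀ {h : ℝ} {M : Mesh d} {Ω : Set (E d)} {I : Type} [Fintype I]
      {φ : Module.Basis I ℝ (feSpace M Ω k)} {S : Finset (E d) → Finset (E d)}
      {Ts : I → Finset (E d)}, IsStabilized φhat ρ γ N h M Ω φ S Ts →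
      ∀ (w : feSpace M Ω k) (i : I) (B : ℝ), 0 ≤ B →
        (∀ T ∈ largeElems M Ω γ, i ∈ localIdx (shape φ) T → ∀ y ∈ body T, |(w : E d → ℝ) y| ≤ B) →
        (i ∈ smallIdx M Ω γ (shape φ) → ∀ y ∈ body (S (Ts i)), |(w : E d → ℝ) y| ≤ B) →
        (i ∉ smallIdx M Ω γ (shape φ) → |φ.repr w i| ≤ C * B) ∧
        (i ∈ smallIdx M Ω γ (shape φ) → |φ.repr w i| ≤
          C * B + |dof (shape φ) i (Ts i) (jump k (w : E d → ℝ) (Ts i) (S (Ts i)))|) := by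
  have hω := unitBall_volume_pos (d := d)
  obtain ⟨C₁, hC₁, hloc⟩ := exists_local_bounds φhat
  obtain ⟨C₂, hC₂, hsup⟩ := exists_sup_le_sup φhat (N + 1 : ℝ)
    (m := ρ ^ d * volume.real (Metric.ball (0 : E d) 1)) (by positivity)
  refine ⟨C₁ + C₁ * C₂, by positivity, ?_⟩
  intro h M Ω I _ φ S Ts hs w i B hB hlarge hsmall
  constructor
  · intro hi
    obtain ⟨T, hT, hiT⟩ : ∃ T ∈ largeElems M Ω γ, i ∈ localIdx (shape φ) T := by
      simpa [smallIdx] using hi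
    have h1 := (hloc M Ω I (shape φ) hs.affine T hT.1 (φ.repr w) w B hB
      (eqOn_local_expansion φ hs.mesh hρ hs.pos w hT.1)).1 (hlarge T hT hiT) i hiT
    have h2 : 0 ≤ C₁ * C₂ * B := by positivity
    linarith
  · intro hi
    obtain ⟨hTa, hiT⟩ := hs.mem i hi
    have hSL := hs.large _ (hs.small hi)
    obtain ⟨hp₁, hwp₁⟩ := polyExt_spec w.2 hTa
    obtain ⟨hp₂, hwp₂⟩ := polyExt_spec w.2 hSL.1
    obtain ⟨x, hx⟩ : (Ts i).Nonempty := Finset.card_pos.1 (by rw [hTa.1.2]; omega)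
    have hsub1 : body (Ts i) ⊆ Metric.closedBall x ((N + 1 : ℝ) * h) := by
      intro y hy
      have h1 := hs.mesh.dist_le hTa.1 hy (mem_body hx)
      have h2 : (0 : ℝ) ≤ N * h := mul_nonneg (Nat.cast_nonneg _) hs.pos.le
      rw [Metric.mem_closedBall]
      linarith
    have hsub2 : body (S (Ts i)) ⊆ Metric.closedBall x ((N + 1 : ℝ) * h) := by
      intro y hy
      have h1 := hs.dist_le hd hi (mem_body hx) hy
      have h2 := hs.pos
      rw [Metric.mem_closedBall, dist_comm]
      linarith
    -- Polynomial extension from `S(T_i)` to `T_i`: both lie in the ball of radius `(N + 1) * h`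
    -- around a vertex of `T_i`.
    have hbound : ∀ y ∈ body (Ts i), |polyExt k (w : E d → ℝ) (S (Ts i)) y| ≤ C₂ * B := by
      intro y hy
      refine (hsup h x (body (S (Ts i))) hs.pos hsub2 (measurableSet_body _)
        (hs.mesh.le_volume hρ hs.pos hSL.1.1) _ hp₂ B (fun y hy => ?_) y (hsub1 hy)).1
      rw [← hwp₂ hy]
      exact hsmall hi y hy
    obtain ⟨c, hc, hcd⟩ := hs.affine.dof_spec hTa (jump_mem_polySpace w.2 hTa hSL.1)
    rw [hcd i]
    -- On `T_i` the extension from `S(T_i)` equals `w` minus the jump, so its coefficients are those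
    -- of `w` minus the degrees of freedom `c` of the jump.
    have h1 := (hloc M Ω I (shape φ) hs.affine (Ts i) hTa (fun j => φ.repr w j - c j)
      (polyExt k (w : E d → ℝ) (S (Ts i))) (C₂ * B) (by positivity) (fun y hy => ?_)).1 hbound i hiT
    · have h2 : |φ.repr w i| ≤ |φ.repr w i - c i| + |c i| := by
        simpa using abs_add_le (φ.repr w i - c i) (c i)
      have h3 : 0 ≤ C₁ * B := by positivity
      linarith
    · have h2 := hc y hy
      have h3 := eqOn_local_expansion φ hs.mesh hρ hs.pos w hTa y hy
      rw [hwp₁ hy] at h3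
      simp only [sub_mul, Finset.sum_sub_distrib]
      rw [← h2, ← h3]
      simp [jump]

/-- Bounds on an active element in terms of neighboring large elements and of the jumps. -/
theorem exists_element_bound [Fintype A] (hd : 1 ≤ d) (φhat : Module.Basis A ℝ (polySpace d k)) {ρ : ℝ}
    (hρ : 0 < ρ) (γ : ℝ) (N : ℕ) :
    ∃ C : ℝ, 0 < C ∧ ∀ {h : ℝ} {M : Mesh d} {Ω : Set (E d)} {I : Type} [Fintype I]
      {φ : Module.Basis I ℝ (feSpace M Ω k)} {S : Finset (E d) → Finset (E d)}
      {Ts : I → Finset (E d)}, IsStabilized φhat ρ γ N h M Ω φ S Ts →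
      ∀ (w : feSpace M Ω k), ∀ T ∈ active M Ω, ∀ B : ℝ, 0 ≤ B →
        (∀ i ∈ localIdx (shape φ) T, ∀ T' ∈ largeElems M Ω γ, i ∈ localIdx (shape φ) T' →
          ∀ y ∈ body T', |(w : E d → ℝ) y| ≤ B) →
        (∀ i ∈ localIdx (shape φ) T, i ∈ smallIdx M Ω γ (shape φ) →
          ∀ y ∈ body (S (Ts i)), |(w : E d → ℝ) y| ≤ B) →
        ∀ y ∈ body T, (w : E d → ℝ) y ^ 2 ≤ C * (B ^ 2 + jumpSum γ φ S Ts w T) ∧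
          (h * ‖gradient (polyExt k (w : E d → ℝ) T) y‖) ^ 2 ≤
            C * (B ^ 2 + jumpSum γ φ S Ts w T) := by
  classical
  have hω := unitBall_volume_pos (d := d)
  obtain ⟨C₀, hC₀, hcoef⟩ := exists_coeff_le hd φhat hρ γ N
  obtain ⟨C₁, hC₁, hloc⟩ := exists_local_bounds φhat
  obtain ⟨C₂, hC₂, hsup⟩ := exists_sup_le_sup φhat (1 : ℝ)
    (m := ρ ^ d * volume.real (Metric.ball (0 : E d) 1)) (by positivity)
  -- The summand `1` serves the values, `C₂` the inverse inequality for the gradient; the factor `2`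
  -- below comes from `(a + b)² ≤ 2 (a² + b²)`.
  set L := (1 + C₂) * C₁ * (C₀ + 1)
  have hL : 0 < L := by positivity
  refine ⟨2 * L ^ 2, by positivity, ?_⟩
  intro h M Ω I _ φ S Ts hs w T hT B hB hlarge hsmall y hy
  set D := jumpSum γ φ S Ts (w : E d → ℝ) T
  have hD : 0 ≤ D := jumpSum_nonneg _ _
  have hc : ∀ i ∈ localIdx (shape φ) T, |φ.repr w i| ≤ (C₀ + 1) * (B + Real.sqrt D) := by
    intro i hi
    obtain ⟨h1, h2⟩ := hcoef hs w i B hB (hlarge i hi) (hsmall i hi)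
    have h3 := Real.sqrt_nonneg D
    have h4 : 0 ≤ C₀ * Real.sqrt D := by positivity
    by_cases his : i ∈ smallIdx M Ω γ (shape φ)
    · have h5 : |dof (shape φ) i (Ts i) (jump k (w : E d → ℝ) (Ts i) (S (Ts i)))| ≤
          Real.sqrt D := by
        refine Real.abs_le_sqrt ?_
        exact Finset.single_le_sum
          (f := fun i => dof (shape φ) i (Ts i) (jump k (w : E d → ℝ) (Ts i) (S (Ts i))) ^ 2)
          (fun _ _ => sq_nonneg _) (Finset.mem_filter.2 ⟨Finset.mem_univ i, hi, his⟩)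
      have h6 := h2 his
      linarith
    · have h6 := h1 his
      linarith
  have hw : ∀ y ∈ body T, |(w : E d → ℝ) y| ≤ C₁ * ((C₀ + 1) * (B + Real.sqrt D)) :=
    (hloc M Ω I (shape φ) hs.affine T hT (φ.repr w) w _ (by positivity)
      (eqOn_local_expansion φ hs.mesh hρ hs.pos w hT)).2 hc
  have hfin : ∀ t : ℝ, 0 ≤ t → t ≤ L * (B + Real.sqrt D) → t ^ 2 ≤ 2 * L ^ 2 * (B ^ 2 + D) := by
    intro t ht0 ht
    have h1 := Real.sq_sqrt hD
    have h2 := sq_nonneg (B - Real.sqrt D)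
    calc t ^ 2 ≤ (L * (B + Real.sqrt D)) ^ 2 := pow_le_pow_left₀ ht0 ht 2
      _ = L ^ 2 * (B + Real.sqrt D) ^ 2 := by ring
      _ ≤ L ^ 2 * (2 * (B ^ 2 + D)) := by
        gcongr
        nlinarith
      _ = _ := by ring
  have hnn : 0 ≤ C₁ * ((C₀ + 1) * (B + Real.sqrt D)) := by positivity
  obtain ⟨hp, hwp⟩ := polyExt_spec w.2 hT
  constructor
  · rw [← sq_abs]
    refine hfin _ (abs_nonneg _) ((hw y hy).trans ?_)
    have : 0 ≤ C₂ * (C₁ * ((C₀ + 1) * (B + Real.sqrt D))) := by positivity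
    simp only [L]
    linarith
  · have hsub : body T ⊆ Metric.closedBall y (1 * h) := fun x hx => by
      rw [one_mul]
      exact hs.mesh.dist_le hT.1 hx hy
    have h1 := (hsup h y (body T) hs.pos hsub (measurableSet_body T)
      (hs.mesh.le_volume hρ hs.pos hT.1) _ hp _ (fun x hx => by rw [← hwp hx]; exact hw x hx) y
      (hsub hy)).2
    refine hfin _ (mul_nonneg hs.pos.le (norm_nonneg _)) (h1.trans ?_)
    simp only [L]
    linarith

end

/-! ### The two stability estimates. -/

section

variable {d k : ℕ} {A : Type}

section

variable {φhat : Module.Basis A ℝ (polySpace d k)} {ρ γ : ℝ} {N : ℕ} {h : ℝ}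
    {M : Mesh d} {Ω : Set (E d)} {I : Type} [Fintype I] {φ : Module.Basis I ℝ (feSpace M Ω k)}
    {S : Finset (E d) → Finset (E d)} {Ts : I → Finset (E d)}

theorem IsStabilized.exists_common_point [Fintype A] (hk : 1 ≤ k) (hρ : 0 < ρ)
    (hs : IsStabilized φhat ρ γ N h M Ω φ S Ts) (i : I) :
    ∃ x, ∀ T ∈ active M Ω, i ∈ localIdx (shape φ) T → x ∈ body T := by
  obtain ⟨x, hx⟩ := exists_common_vertex φ hk hs.mesh hρ hs.pos hs.affine i
  exact ⟨x, fun T hT hi => mem_body (hx T hT hi)⟩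

-- One constant covers both overlap counts: elements near a given `P`, and elements in one support,
-- which share a vertex and hence lie in a ball of radius `h ≤ (R + 2) * h`.
open Classical in
theorem IsStabilized.sum_le [Fintype A] (hk : 1 ≤ k) (hρ : 0 < ρ)
    (hs : IsStabilized φhat ρ γ N h M Ω φ S Ts) {R : ℝ} (hR : 0 ≤ R) {C : ℝ} (hC : 0 ≤ C)
    {X Y : Finset (E d) → ℝ} {Z : I → ℝ} (hY : ∀ P, 0 ≤ Y P) (hZ : ∀ i, 0 ≤ Z i)
    (hX : ∀ T ∈ active M Ω, X T ≤
      C * (∑ P ∈ (finite_largeElems (M := M) (Ω := Ω) (γ := γ)).toFinset with IsNear (R * h) T P,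
        Y P + ∑ i with i ∈ localIdx (shape φ) T ∧ i ∈ smallIdx M Ω γ (shape φ), Z i)) :
    ∑ T ∈ (finite_active (M := M) (Ω := Ω)).toFinset, X T ≤
      C * ((R + 2) / ρ) ^ d *
        (∑ P ∈ (finite_largeElems (M := M) (Ω := Ω) (γ := γ)).toFinset, Y P +
          ∑ i with i ∈ smallIdx M Ω γ (shape φ), Z i) := by
  refine sum_local_le (near := IsNear (R * h)) (loc := localIdx (shape φ)) hC
    (fun P hP => ?_) (fun i => ?_) (fun P _ => hY P) hZ
    (fun T hT => hX T (by simpa using hT))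
  · have hP' : P ∈ largeElems M Ω γ := by simpa using hP
    exact card_near_le hs.mesh hρ hs.pos hR hP'.1.1
      fun T hT => (show T ∈ active M Ω by simpa using hT).1
  · obtain ⟨x, hx⟩ := hs.exists_common_point hk hρ i
    refine hs.mesh.card_le hρ hs.pos (by linarith) x _ fun T hT => ?_
    obtain ⟨hT1, hiT⟩ := Finset.mem_filter.1 hT
    have hTa : T ∈ active M Ω := by simpa using hT1
    refine ⟨hTa.1, fun y hy => ?_⟩
    have h1 := hs.mesh.dist_le hTa.1 hy (hx T hTa hiT)
    have h2 : 0 ≤ (R + 1) * h := mul_nonneg (by linarith) hs.pos.le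
    rw [Metric.mem_closedBall]
    linarith

theorem IsStabilized.le_volume_large (hρ : 0 < ρ) (hγ : 0 < γ)
    (hs : IsStabilized φhat ρ γ N h M Ω φ S Ts) {P : Finset (E d)} (hP : P ∈ largeElems M Ω γ) :
    γ * (ρ ^ d * volume.real (Metric.ball (0 : E d) 1)) * h ^ d ≤ volume.real (body P ∩ Ω) := by
  refine le_trans ?_ hP.2
  rw [mul_assoc]
  exact mul_le_mul_of_nonneg_left (hs.mesh.le_volume hρ hs.pos hP.1.1) hγ.le

open Classical in
theorem stabForm_self {τ : ℝ} {m : ℕ} {v : E d → ℝ} :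
    stabForm k M Ω γ τ h (shape φ) S Ts m v v =
      ∑ i with i ∈ smallIdx M Ω γ (shape φ), τ * h ^ ((d : ℤ) - 2 * (m : ℤ)) *
        dof (shape φ) i (Ts i) (jump k v (Ts i) (S (Ts i))) ^ 2 := by
  rw [stabForm]
  exact Finset.sum_congr rfl fun i _ => by ring

open Classical in
theorem sum_weighted_dof {τ : ℝ} {m : ℕ} {v : E d → ℝ} {T : Finset (E d)} :
    ∑ i with i ∈ localIdx (shape φ) T ∧ i ∈ smallIdx M Ω γ (shape φ),
      τ * h ^ ((d : ℤ) - 2 * (m : ℤ)) *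
        dof (shape φ) i (Ts i) (jump k v (Ts i) (S (Ts i))) ^ 2 =
      τ * h ^ ((d : ℤ) - 2 * (m : ℤ)) * jumpSum γ φ S Ts v T := by
  rw [jumpSum, Finset.mul_sum]

/-- Turns a bound for `h ^ d` times a square into a pointwise bound `B` whose square rescales
exactly to the given integral quantity. -/
theorem exists_mul_sq_eq {a b : ℝ} (ha : 0 < a) (hb : 0 ≤ b) : ∃ B : ℝ, 0 ≤ B ∧ a * B ^ 2 = b :=
  ⟨Real.sqrt (b / a), Real.sqrt_nonneg _, by
    rw [Real.sq_sqrt (by positivity)]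
    field_simp⟩

end

/-- Stability of the `L²` norm. -/
theorem exists_normSq_le [Fintype A] (hd : 1 ≤ d) (hk : 1 ≤ k)
    (φhat : Module.Basis A ℝ (polySpace d k)) {ρ γ τ : ℝ} (hρ : 0 < ρ) (hγ : 0 < γ) (hτ : 0 < τ)
    (N : ℕ) :
    ∃ C : ℝ, 0 < C ∧ ∀ {h : ℝ} {M : Mesh d} {Ω : Set (E d)} {I : Type} [Fintype I]
      {φ : Module.Basis I ℝ (feSpace M Ω k)} {S : Finset (E d) → Finset (E d)}
      {Ts : I → Finset (E d)}, IsStabilized φhat ρ γ N h M Ω φ S Ts →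
      ∀ v ∈ feSpace M Ω k, normSq (activeDomain M Ω) v ≤
        C * (normSq Ω v + stabForm k M Ω γ τ h (shape φ) S Ts 0 v v) := by
  classical
  have hω := unitBall_volume_pos (d := d)
  set ω := volume.real (Metric.ball (0 : E d) 1)
  obtain ⟨C₁, hC₁, helem⟩ := exists_element_bound hd φhat hρ γ N
  obtain ⟨C₂, hC₂, hsup⟩ := exists_sup_le_integral φhat (1 : ℝ)
    (m := γ * (ρ ^ d * ω)) (by positivity)
  have hK : 0 < (((N : ℝ) + 2) / ρ) ^ d := by positivity
  refine ⟨ω * C₁ * (C₂ + τ⁻¹) * (((N : ℝ) + 2) / ρ) ^ d, by positivity, ?_⟩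
  intro h M Ω I _ φ S Ts hs v hv
  have hh := hs.pos
  have hhd : 0 < h ^ d := by positivity
  have hΩm := hs.isClosed.measurableSet
  let Y : Finset (E d) → ℝ := fun P => ∫ x in body P ∩ Ω, v x ^ 2
  have hY : ∀ P, 0 ≤ Y P := fun P => integral_nonneg fun x => sq_nonneg _
  have hpt : ∀ P ∈ largeElems M Ω γ, ∀ y ∈ body P, h ^ d * v y ^ 2 ≤ C₂ * Y P := by
    intro P hP y hy
    obtain ⟨hp, hvp⟩ := polyExt_spec hv hP.1
    have hsub : body P ⊆ Metric.closedBall y (1 * h) := fun x hx => by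
      rw [one_mul]
      exact hs.mesh.dist_le hP.1.1 hx hy
    have h1 := (hsup h y (body P ∩ Ω) hh (Set.inter_subset_left.trans hsub)
      ((measurableSet_body P).inter hΩm) (hs.le_volume_large hρ hγ hP) _ hp y (hsub hy)).1
    rwa [← hvp hy, ← integral_sq_eq hv hP.1 hΩm] at h1
  -- The radius `N * h` suffices: the large elements used for `T` either share a vertex with `T` or
  -- are some `S(T_i)`, within `N * h` of a vertex that `T` and `T_i` share.
  have hmain := hs.sum_le hk hρ (R := (N : ℝ)) (Nat.cast_nonneg N) (C := ω * C₁ * (C₂ + τ⁻¹))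
    (by positivity) (X := fun T => ∫ x in body T, v x ^ 2) (Y := Y)
    (Z := fun i => τ * h ^ ((d : ℤ) - 2 * ((0 : ℕ) : ℤ)) *
      dof (shape φ) i (Ts i) (jump k v (Ts i) (S (Ts i))) ^ 2) hY
    (fun i => by positivity) ?_
  · rw [normSq, integral_activeDomain fun T hT => integrableOn_sq hv hT, stabForm_self]
    refine hmain.trans ?_
    have h1 := sum_integral_large_le (γ := γ) hs.isClosed hs.subset (f := fun x => v x ^ 2)
      (fun x => sq_nonneg _) fun T hT => integrableOn_sq hv hT
    rw [normSq]
    gcongr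
  · intro T hT
    rw [sum_weighted_dof]
    set G := ∑ P ∈ (finite_largeElems (M := M) (Ω := Ω) (γ := γ)).toFinset
      with IsNear (N * h) T P, Y P
    have hG : 0 ≤ G := Finset.sum_nonneg fun P _ => hY P
    set D := jumpSum γ φ S Ts v T
    have hD : 0 ≤ D := jumpSum_nonneg _ _
    obtain ⟨B, hB, hBG⟩ := exists_mul_sq_eq hhd (mul_nonneg hC₂.le hG)
    have hnear : ∀ P ∈ largeElems M Ω γ, IsNear (N * h) T P → ∀ y ∈ body P, |v y| ≤ B := by
      intro P hP hTP y hy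
      have h1 : Y P ≤ G := Finset.single_le_sum (f := Y) (fun P _ => hY P)
        (Finset.mem_filter.2 ⟨by simpa using hP, hTP⟩)
      refine abs_le_of_sq_le_sq (le_of_mul_le_mul_left ?_ hhd) hB
      rw [hBG]
      exact (hpt P hP y hy).trans (by gcongr)
    have hbd := helem hs ⟨v, hv⟩ T hT B hB ?_ ?_
    · have h1 := setIntegral_body_le hs.mesh hh hT.1 (integrableOn_sq hv hT)
        (B := C₁ * (B ^ 2 + D)) (by positivity) fun x hx => (hbd x hx).1
      refine h1.trans ?_
      have h2 : h ^ d * (C₁ * (B ^ 2 + D)) = C₁ * (C₂ * G + h ^ d * D) := by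
        rw [← hBG]
        ring
      have h3 : τ * h ^ ((d : ℤ) - 2 * ((0 : ℕ) : ℤ)) * D = τ * (h ^ d * D) := by
        simp [mul_assoc]
      have h4 : 0 ≤ h ^ d * D := by positivity
      have h5 : C₂ * G + h ^ d * D ≤ (C₂ + τ⁻¹) * (G + τ * (h ^ d * D)) := by
        have h6 : (C₂ + τ⁻¹) * (G + τ * (h ^ d * D)) =
            C₂ * G + h ^ d * D + (τ⁻¹ * G + C₂ * (τ * (h ^ d * D))) := by
          field_simp
          ring
        have h7 : 0 ≤ τ⁻¹ * G + C₂ * (τ * (h ^ d * D)) := by positivity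
        linarith
      rw [h2, h3]
      calc ω * (C₁ * (C₂ * G + h ^ d * D)) ≤ ω * (C₁ * ((C₂ + τ⁻¹) * (G + τ * (h ^ d * D)))) := by
            gcongr
        _ = _ := by ring
    · intro i hi T' hT' hi'
      obtain ⟨x, hx⟩ := hs.exists_common_point hk hρ i
      refine hnear T' hT' ⟨x, hx T hT hi, x, hx T' hT'.1 hi', ?_⟩
      rw [dist_self]
      positivity
    · intro i hi his
      obtain ⟨x, hx⟩ := hs.exists_common_point hk hρ i
      obtain ⟨hTa, hiT⟩ := hs.mem i his
      have hSL := hs.large _ (hs.small his)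
      obtain ⟨z, hz⟩ : (S (Ts i)).Nonempty := Finset.card_pos.1 (by rw [hSL.1.1.2]; omega)
      exact hnear _ hSL ⟨x, hx T hT hi, z, mem_body hz,
        hs.dist_le hd his (hx _ hTa hiT) (mem_body hz)⟩

/-- Stability of the `L²` norm of the gradient. -/
theorem exists_gradNormSq_le [Fintype A] (hd : 1 ≤ d) (hk : 1 ≤ k)
    (φhat : Module.Basis A ℝ (polySpace d k)) {ρ γ τ : ℝ} (hρ : 0 < ρ) (hγ : 0 < γ) (hτ : 0 < τ)
    (N : ℕ) :
    ∃ C : ℝ, 0 < C ∧ ∀ {h : ℝ} {M : Mesh d} {Ω : Set (E d)} {I : Type} [Fintype I]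
      {φ : Module.Basis I ℝ (feSpace M Ω k)} {S : Finset (E d) → Finset (E d)}
      {Ts : I → Finset (E d)}, IsStabilized φhat ρ γ N h M Ω φ S Ts →
      LargePathAssumption M Ω γ (shape φ) S N →
      ∀ v ∈ feSpace M Ω k, gradNormSq (activeDomain M Ω) v ≤
        C * (gradNormSq Ω v + stabForm k M Ω γ τ h (shape φ) S Ts 1 v v) := by
  classical
  have hω := unitBall_volume_pos (d := d)
  set ω := volume.real (Metric.ball (0 : E d) 1)
  obtain ⟨C₁, hC₁, helem⟩ := exists_element_bound hd φhat hρ γ N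
  obtain ⟨C₂, hC₂, hsup⟩ := exists_gradient_sup_le_integral φhat (1 : ℝ)
    (m := γ * (ρ ^ d * ω)) (by positivity)
  -- `C₂` serves large elements; on small ones `N ^ 2 * C₂` comes from the squared oscillation along
  -- a path and `τ⁻¹` from the weight of the jumps.
  set C₃ : ℝ := C₂ + C₁ * (N ^ 2 * C₂ + τ⁻¹)
  have hC₃ : 0 < C₃ := by positivity
  have hK : 0 < ((2 * (N : ℝ) + 2) / ρ) ^ d := by positivity
  refine ⟨ω * C₃ * ((2 * (N : ℝ) + 2) / ρ) ^ d, by positivity, ?_⟩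
  intro h M Ω I _ φ S Ts hs hLP v hv
  have hh := hs.pos
  have hhd : 0 < h ^ d := by positivity
  have hΩm := hs.isClosed.measurableSet
  let Y : Finset (E d) → ℝ := fun P => ∫ x in body P ∩ Ω, ‖gradient v x‖ ^ 2
  have hY : ∀ P, 0 ≤ Y P := fun P => integral_nonneg fun x => sq_nonneg _
  have hpt : ∀ P ∈ largeElems M Ω γ, ∀ y ∈ body P,
      h ^ d * ‖gradient (polyExt k v P) y‖ ^ 2 ≤ C₂ * Y P := by
    intro P hP y hy
    obtain ⟨hp, hvp⟩ := polyExt_spec hv hP.1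
    have hsub : body P ⊆ Metric.closedBall y (1 * h) := fun x hx => by
      rw [one_mul]
      exact hs.mesh.dist_le hP.1.1 hx hy
    have h1 := hsup h y (body P ∩ Ω) hh (Set.inter_subset_left.trans hsub)
      ((measurableSet_body P).inter hΩm) (hs.le_volume_large hρ hγ hP) _ hp y (hsub hy)
    rwa [← integral_gradient_sq_eq hv hP.1 hΩm] at h1
  have hint : ∀ T ∈ active M Ω, ∫ x in body T, ‖gradient v x‖ ^ 2 =
      ∫ x in body T, ‖gradient (polyExt k v T) x‖ ^ 2 := by
    intro T hT
    have := integral_gradient_sq_eq hv hT MeasurableSet.univ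
    simpa using this
  -- A path of large elements starts within `N * h` of a point of `T` and stays within another `N *
  -- h`, whence the radius `2 * N * h`.
  have hmain := hs.sum_le hk hρ (R := 2 * (N : ℝ)) (by positivity) (C := ω * C₃)
    (by positivity) (X := fun T => ∫ x in body T, ‖gradient v x‖ ^ 2) (Y := Y)
    (Z := fun i => τ * h ^ ((d : ℤ) - 2 * ((1 : ℕ) : ℤ)) *
      dof (shape φ) i (Ts i) (jump k v (Ts i) (S (Ts i))) ^ 2) hY
    (fun i => by positivity) ?_
  · rw [gradNormSq, integral_activeDomain fun T hT => integrableOn_gradient_sq hv hT,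
      stabForm_self]
    refine hmain.trans ?_
    have h1 := sum_integral_large_le (γ := γ) hs.isClosed hs.subset
      (f := fun x => ‖gradient v x‖ ^ 2) (fun x => sq_nonneg _)
      fun T hT => integrableOn_gradient_sq hv hT
    rw [gradNormSq]
    gcongr
  · intro T hT
    rw [sum_weighted_dof]
    set G := ∑ P ∈ (finite_largeElems (M := M) (Ω := Ω) (γ := γ)).toFinset
      with IsNear (2 * N * h) T P, Y P
    have hG : 0 ≤ G := Finset.sum_nonneg fun P _ => hY P
    set D := jumpSum γ φ S Ts v T
    have hD : 0 ≤ D := jumpSum_nonneg _ _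
    set t := h ^ ((d : ℤ) - 2 * ((1 : ℕ) : ℤ))
    have ht : 0 < t := by positivity
    -- The exponent `d - 2` may be negative, so this is an identity of integer powers.
    have hth : h ^ d = h ^ 2 * t := by
      simp only [t]
      rw [← zpow_natCast, ← zpow_natCast, ← zpow_add₀ hh.ne']
      congr 1
      push_cast
      ring
    obtain ⟨g, hg, hgG⟩ := exists_mul_sq_eq hhd (mul_nonneg hC₂.le hG)
    have hnear : ∀ P ∈ largeElems M Ω γ, IsNear (2 * N * h) T P →
        ∀ y ∈ body P, ‖gradient (polyExt k v P) y‖ ≤ g := by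
      intro P hP hTP y hy
      have h1 : Y P ≤ G := Finset.single_le_sum (f := Y) (fun P _ => hY P)
        (Finset.mem_filter.2 ⟨by simpa using hP, hTP⟩)
      refine le_of_sq_le_sq ?_ hg
      refine le_of_mul_le_mul_left ?_ hhd
      rw [hgG]
      exact (hpt P hP y hy).trans (by gcongr)
    have hgoal : ∀ B : ℝ, 0 ≤ B → h ^ d * B ≤ C₃ * (G + τ * t * D) →
        (∀ x ∈ body T, ‖gradient (polyExt k v T) x‖ ^ 2 ≤ B) →
        ∫ x in body T, ‖gradient v x‖ ^ 2 ≤ ω * C₃ * (G + τ * t * D) := by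
      intro B hB0 hB hb
      rw [hint T hT]
      refine (setIntegral_body_le hs.mesh hh hT.1
        (integrableOn_body (continuous_norm_gradient_sq (polyExt_spec hv hT).1) T) hB0 hb).trans ?_
      rw [mul_assoc]
      gcongr
    by_cases hTL : T ∈ largeElems M Ω γ
    · refine hgoal (g ^ 2) (sq_nonneg g) ?_ fun x hx => ?_
      · rw [hgG]
        have h1 : C₂ ≤ C₃ := le_add_of_nonneg_right (by positivity)
        have h2 : 0 ≤ τ * t * D := by positivity
        exact mul_le_mul h1 (by linarith) hG hC₃.le
      · refine pow_le_pow_left₀ (norm_nonneg _) (hnear T hTL ⟨x, hx, x, hx, ?_⟩ x hx) 2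
        rw [dist_self]
        positivity
    · have hTS : T ∈ smallElems M Ω γ := ⟨hT, hTL⟩
      have hSL := hs.large T hTS
      obtain ⟨z, hz⟩ : (S T).Nonempty := Finset.card_pos.1 (by rw [hSL.1.1.2]; omega)
      -- The shift by `v z`, with `z` a vertex of `S(T)`, makes `w` vanish at the end of every path
      -- to `S(T)`; constants belong to the finite element space and cancel in gradients and jumps.
      set w : feSpace M Ω k :=
        ⟨v - v z • restrictTo (activeDomain M Ω) fun _ => 1,
          sub_mem hv (Submodule.smul_mem _ _ one_mem_feSpace)⟩
      have hw : ∀ {P}, P ∈ active M Ω → ∀ y ∈ body P, (w : E d → ℝ) y = v y - v z := by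
        intro P hP y hy
        have h1 := restrictTo_eqOn hP (fun _ => (1 : ℝ)) hy
        simp [w, h1]
      have hwext : ∀ {P}, P ∈ active M Ω →
          polyExt k (w : E d → ℝ) P = polyExt k v P - fun _ => v z :=
        fun hP => polyExt_sub_const hs.mesh hρ hh hv (v z) hP
      have hwgrad : gradient (polyExt k (w : E d → ℝ) T) = gradient (polyExt k v T) := by
        rw [hwext hT]
        ext1 x
        rw [gradient, gradient]
        congr 1
        exact fderiv_sub_const (v z)
      have hwD : jumpSum γ φ S Ts (w : E d → ℝ) T = D := by
        refine Finset.sum_congr rfl fun i hi => ?_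
        have his := (Finset.mem_filter.1 hi).2.2
        have hjump : jump k (w : E d → ℝ) (Ts i) (S (Ts i)) = jump k v (Ts i) (S (Ts i)) := by
          rw [jump, hwext (hs.mem i his).1, hwext (hs.large _ (hs.small his)).1, jump]
          abel
        rw [hjump]
      -- Mean value inequality on the convex element `P`, of diameter at most `h`.
      have hosc : ∀ P ∈ largeElems M Ω γ, IsNear (2 * N * h) T P →
          ∀ x ∈ body P, ∀ y ∈ body P, dist (v x) (v y) ≤ h * g := by
        intro P hP hTP x hx y hy
        obtain ⟨hp, hvp⟩ := polyExt_spec hv hP.1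
        have h1 := (convex_convexHull ℝ (P : Set (E d))).norm_image_sub_le_of_norm_fderiv_le
          (f := polyExt k v P) (C := g) (𝕜 := ℝ)
          (fun x _ => differentiable_of_mem_polySpace hp x)
          (fun x hx => by rw [← norm_gradient]; exact hnear P hP hTP x hx) hy hx
        rw [hvp hx, hvp hy, dist_eq_norm]
        refine h1.trans ?_
        rw [mul_comm, ← dist_eq_norm]
        exact mul_le_mul_of_nonneg_right (hs.mesh.dist_le hP.1.1 hx hy) hg
      have hpath : ∀ P, HasPath (largeElems M Ω γ) N P (S T) →
          (∃ x ∈ body T, ∀ y ∈ body P, dist x y ≤ N * h) → P ∈ largeElems M Ω γ →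
          ∀ y ∈ body P, |(w : E d → ℝ) y| ≤ N * (h * g) := by
        rintro P hP ⟨x, hx, hxP⟩ hPL y hy
        rw [hw hPL.1 y hy, ← Real.dist_eq]
        -- The path is first confined to elements near `P`, because the gradient bound `g` is
        -- available only for large elements close to `T`.
        refine (hP.near hd hs.mesh hh fun _ h => h.1.1).dist_le hd (by positivity)
          (fun Q hQ => hosc Q hQ.1 ?_) y hy z (mem_body hz)
        obtain ⟨q, hq⟩ : Q.Nonempty := Finset.card_pos.1 (by rw [hQ.1.1.1.2]; omega)
        refine ⟨x, hx, q, mem_body hq, ?_⟩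
        have h1 := hQ.2 y hy q (mem_body hq)
        have h2 := hxP y hy
        have h3 := dist_triangle x y q
        linarith
      have hbd := helem hs w T hT (N * (h * g)) (by positivity) ?_ ?_
      · rw [hwD, hwgrad] at hbd
        refine hgoal (C₁ * ((N * (h * g)) ^ 2 + D) / h ^ 2) (by positivity) ?_ fun x hx => ?_
        · have h1 : h ^ d * (C₁ * ((N * (h * g)) ^ 2 + D) / h ^ 2) =
              C₁ * (N ^ 2 * (h ^ d * g ^ 2) + t * D) := by
            rw [hth]
            field_simp
          rw [h1, hgG]
          have h2 : C₃ * (G + τ * t * D) = C₁ * (N ^ 2 * (C₂ * G) + t * D) +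
              (C₂ * (G + τ * t * D) + C₁ * (N ^ 2 * C₂ * (τ * t * D) + τ⁻¹ * G)) := by
            simp only [C₃]
            field_simp
            ring
          have h3 : 0 ≤ C₂ * (G + τ * t * D) +
              C₁ * (N ^ 2 * C₂ * (τ * t * D) + τ⁻¹ * G) := by positivity
          linarith
        · rw [le_div_iff₀ (by positivity), mul_comm, ← mul_pow]
          exact (hbd x hx).2
      · intro i hi T' hT' hi'
        obtain ⟨x, hx⟩ := hs.exists_common_point hk hρ i
        obtain hP := hLP.2 i T' hT' T hTS hi' hi
        -- A path has at least one element, so `N ≥ 1`, and the diameter bound `h` for `T'` is at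
        -- most `N * h`.
        have hN : (1 : ℝ) ≤ N := by
          obtain ⟨n, -, h1, h2, -⟩ := hP
          exact_mod_cast h1.trans h2
        refine hpath T' hP ⟨x, hx T hT hi, fun y hy => ?_⟩ hT'
        have h1 := hs.mesh.dist_le hT'.1.1 (hx T' hT'.1 hi') hy
        have h2 : 1 * h ≤ N * h := by gcongr
        linarith
      · intro i hi his
        obtain ⟨x, hx⟩ := hs.exists_common_point hk hρ i
        obtain ⟨hTa, hiT⟩ := hs.mem i his
        refine hpath _ (hLP.1 i (Ts i) (hs.small his) T hTS hiT hi)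
          ⟨x, hx T hT hi, fun y hy => ?_⟩ (hs.large _ (hs.small his))
        exact hs.dist_le hd his (hx _ hTa hiT) hy

end

end NodalStab

theorem lemma3p5 (d k : ℕ) (hd : 1 ≤ d) (hk : 1 ≤ k) {A : Type} [Fintype A]
    (φhat : Module.Basis A ℝ (NodalStab.polySpace d k))
    (ρ γ τ : ℝ) (hρ : 0 < ρ) (hγ : 0 < γ) (hγ1 : γ ≤ 1) (hτ : 0 < τ) (N : ℕ) :
    ∃ C : ℝ, 0 < C ∧
      ∀ (h : ℝ) (M : NodalStab.Mesh d) (Ω : Set (NodalStab.E d)),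
        0 < h → M.IsQuasiuniform h ρ → IsClosed Ω → Ω ⊆ M.domain →
      ∀ (I : Type) [Fintype I] (φ : Module.Basis I ℝ (NodalStab.feSpace M Ω k)),
        NodalStab.IsAffineEquivalent M Ω φhat (fun i => (φ i : NodalStab.E d → ℝ)) →
      ∀ (S : Finset (NodalStab.E d) → Finset (NodalStab.E d)) (Ts : I → Finset (NodalStab.E d)),
        (∀ T ∈ NodalStab.smallElems M Ω γ, S T ∈ NodalStab.largeElems M Ω γ) →
        (∀ i ∈ NodalStab.smallIdx M Ω γ (fun i => (φ i : NodalStab.E d → ℝ)),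
          Ts i ∈ NodalStab.active M Ω ∧
            i ∈ NodalStab.localIdx (fun i => (φ i : NodalStab.E d → ℝ)) (Ts i)) →
        NodalStab.PathAssumption M Ω γ (fun i => (φ i : NodalStab.E d → ℝ)) S Ts N →
        (∀ v ∈ NodalStab.feSpace M Ω k,
          NodalStab.normSq (NodalStab.activeDomain M Ω) v ≤
            C * (NodalStab.normSq Ω v +
              NodalStab.stabForm k M Ω γ τ h (fun i => (φ i : NodalStab.E d → ℝ)) S Ts 0 v v)) ∧
        (NodalStab.LargePathAssumption M Ω γ (fun i => (φ i : NodalStab.E d → ℝ)) S N →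
          ∀ v ∈ NodalStab.feSpace M Ω k,
            NodalStab.gradNormSq (NodalStab.activeDomain M Ω) v ≤
              C * (NodalStab.gradNormSq Ω v +
                NodalStab.stabForm k M Ω γ τ h (fun i => (φ i : NodalStab.E d → ℝ)) S Ts 1 v v)) := by
  obtain ⟨C₁, hC₁, h₁⟩ := NodalStab.exists_normSq_le hd hk φhat hρ hγ hτ N
  obtain ⟨C₂, hC₂, h₂⟩ := NodalStab.exists_gradNormSq_le hd hk φhat hρ hγ hτ N
  refine ⟨max C₁ C₂, lt_max_of_lt_left hC₁, ?_⟩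
  intro h M Ω hh hM hΩ hsub I _ φ hφ S Ts hS hTs hpath
  have hs : NodalStab.IsStabilized φhat ρ γ N h M Ω φ S Ts :=
    ⟨hh, hM, hΩ, hsub, hφ, hS, hTs, hpath⟩
  -- Passing to the larger of the two constants requires the right-hand sides to be nonnegative.
  have hstab : ∀ (m : ℕ) (v : NodalStab.E d → ℝ),
      0 ≤ NodalStab.stabForm k M Ω γ τ h (NodalStab.shape φ) S Ts m v v := by
    intro m v
    rw [NodalStab.stabForm_self]
    exact Finset.sum_nonneg fun i _ => by positivity
  refine ⟨fun v hv => (h₁ hs v hv).trans ?_, fun hLP v hv => (h₂ hs hLP v hv).trans ?_⟩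
  · refine mul_le_mul_of_nonneg_right (le_max_left _ _) (add_nonneg ?_ (hstab 0 v))
    exact integral_nonneg fun x => sq_nonneg _
  · refine mul_le_mul_of_nonneg_right (le_max_right _ _) (add_nonneg ?_ (hstab 1 v))
    exact integral_nonneg fun x => sq_nonneg _
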